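/- **Conventions.** A partition $\mu$ is identified with its Young diagram, the boxes $(i,j)$ in column $i$ and row $j$ with $1\le i\le \mu_j$, the row $j+1$ lying above the row $j$; $\mu^t$ is the conjugate partition and $1^k$ the partition consisting of one column with $k$ boxes. For a filling $\sigma:\lambda\to\{1,2,\dots\}$ of the boxes of $\lambda$, a box outside the first row is a descent if its entry is strictly larger than the entry directly below it, and $\operatorname{maj}(\sigma)$ is the sum over all descents $\square$ of $1$ plus the number of boxes above $\square$ in its column. The number $\operatorname{inv}(\sigma)$ counts the pairs $(\square_1,\square_2)$ of boxes in the same row, $\square_1$ to the left of $\square_2$, such that, with $a=\sigma(\square_1)$, $b=\sigma(\square_2)$ and $c$ the entry directly below $\square_1$ ($c=0$ if $\square_1$ is in the first row), $a\le c<b$ or $c<b<a$ or $b<a\le c$. The Macdonald polynomials are $$\tilde H_\lambda(\boldsymbol x;q,t)=\sum_{\sigma:\lambda\to\{1,2,\dots\}}q^{\operatorname{inv}(\sigma)}\,t^{\operatorname{maj}(\sigma)}\prod_{\square\in\lambda}x_{\sigma(\square)} .$$ For partitions $\lambda^1,\dots,\lambda^r$ and $B\subseteq[r]$ let $\lambda^B=\bigoplus_{b\in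 B}\lambda^b$ be their sum, taken part by part. The Macdonald cumulant is $$\kappa(\lambda^1,\dots,\lambda^r)=\frac{1}{(q-1)^{r-1}}\sum_{\pi}(-1)^{\#\pi-1}(\#\pi-1)!\prod_{B\in\pi}\tilde H_{\lambda^B}(\boldsymbol x;q,t),$$ where $\pi$ runs over all set partitions of $[r]$, and the fully colored Macdonald polynomial of $\mu$ is $$\bar H_\mu(\boldsymbol x;q,t)=\kappa\bigl(1^{\mu^t_1},1^{\mu^t_2},\dots,1^{\mu^t_{\mu_1}}\bigr),$$ with $\bar H_\emptyset=1$ for the empty partition. It has coefficients in $\mathbb Q(q,t)$. **Proposition.** Let $\mu$ be a partition of $n\ge 0$. The coefficients of $\bar H_\mu(\boldsymbol x;q,t)$ have no pole at $q=-1$, and the specialization $\bar H_\mu(\boldsymbol x;-1,t)$ is $t$-positive in the monomial basis and in the fundamental quasisymmetric basis. That is, there are polynomials $c_\nu(t)$ (for the partitions $\nu$ of $n$) and $d_D(t)$ (for the subsets $D\subseteq\{1,\dots,n-1\}$), all with nonnegative integer coefficients, such that $$\bar H_\mu(\boldsymbol x;-1,t)=\sum_{\nu\vdash n}c_\nu(t)\,m_\nu(\boldsymbol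 x)=\sum_{D\subseteq\{1,\dots,n-1\}}d_D(t)\,F_{n,D}(\boldsymbol x),$$ where $m_\nu$ is the monomial symmetric function and $$F_{n,D}(\boldsymbol x)=\sum_{\substack{1\le i_1\le\cdots\le i_n\\ j\in D\Rightarrow i_j<i_{j+1}}}x_{i_1}\cdots x_{i_n}.$$ -/

import Mathlib

open Finset

/-! Partitions are identified with Young diagrams: `YoungDiagram` is Mathlib's, whose cell `(i, j)`
lies in row `i` and column `j`, both counted from `0`. The cell `(i + 1, j)` is the one directly
"above" `(i, j)` in the French convention. -/

namespace ColoredMacdonald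

noncomputable section

/-- The entry-wise sum `⊕_{b ∈ B} L b` of partitions: its `i`-th part is the sum of the `i`-th
parts of the `L b`. -/
def oplus {ι : Type*} (B : Finset ι) (L : ι → YoungDiagram) : YoungDiagram where
  cells := (range (∑ b ∈ B, (L b).colLen 0) ×ˢ range (∑ b ∈ B, (L b).rowLen 0)).filter
    fun c => c.2 < ∑ b ∈ B, (L b).rowLen c.1
  isLowerSet := by
    rintro ⟨i, j⟩ ⟨i', j'⟩ hle h
    obtain ⟨hi, hj⟩ := Prod.mk_le_mk.1 hle
    simp only [coe_filter, mem_product, mem_range, Set.mem_ofPred_eq] at h ⊢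
    exact ⟨⟨hi.trans_lt h.1.1, hj.trans_lt h.1.2⟩,
      hj.trans_lt (h.2.trans_le (sum_le_sum fun b _ => (L b).rowLen_anti _ _ hi))⟩

/-- The bounding rectangle in the definition of `oplus` excludes nothing. -/
theorem mem_oplus {ι : Type*} (B : Finset ι) (L : ι → YoungDiagram) (i j : ℕ) :
    (i, j) ∈ oplus B L ↔ j < ∑ b ∈ B, (L b).rowLen i := by
  rw [← YoungDiagram.mem_cells]
  simp only [oplus, mem_filter, mem_product, mem_range, and_iff_right_iff_imp]
  intro h
  constructor
  · obtain ⟨b, hb, hpos⟩ : ∃ b ∈ B, 0 < (L b).rowLen i := by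
      by_contra! hcon
      have h0 := sum_eq_zero fun b hb => Nat.le_zero.1 (hcon b hb)
      omega
    have h1 : i < (L b).colLen 0 :=
      YoungDiagram.mem_iff_lt_colLen.1 (YoungDiagram.mem_iff_lt_rowLen.2 hpos)
    exact h1.trans_le (single_le_sum (f := fun b => (L b).colLen 0) (fun _ _ => Nat.zero_le _) hb)
  · exact h.trans_le (sum_le_sum fun b _ => (L b).rowLen_anti _ _ (Nat.zero_le i))

/-- The one-column partition `1^k`. -/
def column (k : ℕ) : YoungDiagram where
  cells := range k ×ˢ {0}
  isLowerSet := by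
    rintro ⟨i, j⟩ ⟨i', j'⟩ hle h
    obtain ⟨hi, hj⟩ := Prod.mk_le_mk.1 hle
    simp only [coe_product, coe_range, coe_singleton, Set.mem_prod, Set.mem_Iio,
      Set.mem_singleton_iff] at h ⊢
    omega

/-- A filling of the boxes of a Young diagram by positive integers. -/
abbrev Filling (nu : YoungDiagram) : Type := nu.cells → ℕ+

namespace Filling

variable {nu : YoungDiagram}

/-- The entry of a filling in the box `c` (and `0` outside the diagram). -/
def entry (σ : Filling nu) (c : ℕ × ℕ) : ℕ :=
  if h : c ∈ nu.cells then (σ ⟨c, h⟩ : ℕ) else 0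

/-- The entry directly below the box `c`; below the first row it is, by convention, `0`, which is
smaller than all entries. -/
def entryBelow (σ : Filling nu) : ℕ × ℕ → ℕ
  | (0, _) => 0
  | (i + 1, j) => σ.entry (i, j)

/-- The descent set: boxes, not in the first row, whose entry exceeds the entry directly below. -/
def des (σ : Filling nu) : Finset (ℕ × ℕ) :=
  nu.cells.filter fun c => c.1 ≠ 0 ∧ σ.entryBelow c < σ.entry c

/-- The leg-length of a box: the number of boxes above it in its column. -/
def leg (nu : YoungDiagram) (c : ℕ × ℕ) : ℕ := nu.colLen c.2 - (c.1 + 1)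

/-- The major index. -/
def maj (σ : Filling nu) : ℕ := ∑ c ∈ σ.des, (leg nu c + 1)

/-- The set of inversion pairs: pairs of boxes `(□₁, □₂)` in the same row, `□₁` to the left of
`□₂`, such that the entries of `□₁`, `□₂` and of the box `□₃` directly below `□₁` are
counterclockwise increasing. -/
def invPairs (σ : Filling nu) : Finset ((ℕ × ℕ) × (ℕ × ℕ)) :=
  (nu.cells ×ˢ nu.cells).filter fun p =>
    p.1.1 = p.2.1 ∧ p.1.2 < p.2.2 ∧
      ((σ.entry p.1 ≤ σ.entryBelow p.1 ∧ σ.entryBelow p.1 < σ.entry p.2) ∨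
        (σ.entryBelow p.1 < σ.entry p.2 ∧ σ.entry p.2 < σ.entry p.1) ∨
        (σ.entry p.2 < σ.entry p.1 ∧ σ.entry p.1 ≤ σ.entryBelow p.1))

/-- The statistic `inv`, the number of inversion pairs. -/
def inv (σ : Filling nu) : ℕ := #σ.invPairs

/-- The exponent of the monomial `x^σ = ∏_□ x_{σ(□)}`. -/
def content (σ : Filling nu) : ℕ+ →₀ ℕ := ∑ c, Finsupp.single (σ c) 1

end Filling

/-- The finite set of all fillings `σ` of `nu` with `x^σ = x^d`. -/
def fillings (nu : YoungDiagram) (d : ℕ+ →₀ ℕ) : Finset (Filling nu) :=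
  (Fintype.piFinset fun _ : nu.cells => d.support).filter fun σ => σ.content = d

theorem mem_fillings (nu : YoungDiagram) (d : ℕ+ →₀ ℕ) (σ : Filling nu) :
    σ ∈ fillings nu d ↔ σ.content = d := by
  simp only [fillings, mem_filter, Fintype.mem_piFinset, and_iff_right_iff_imp]
  rintro rfl c
  rw [Finsupp.mem_support_iff, Filling.content, Finsupp.finsetSum_apply]
  exact (lt_of_lt_of_le (by simp) (single_le_sum
    (f := fun c' => (Finsupp.single (σ c') 1 : ℕ+ →₀ ℕ) (σ c)) (fun _ _ => Nat.zero_le _)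
    (mem_univ c))).ne'

/-- The (modified) Macdonald polynomial `∑_σ q^{inv σ} t^{maj σ} x^σ`, the sum over all fillings
of `nu`, as a formal power series in `x₁, x₂, …`. -/
def macdonald {R : Type*} [CommRing R] (q t : R) (nu : YoungDiagram) : MvPowerSeries ℕ+ R :=
  fun d => ∑ σ ∈ fillings nu d, q ^ σ.inv * t ^ σ.maj

/-- The joint cumulant of a family `(u_B)` indexed by the subsets `B` of a finite set. -/
def jointCumulant {ι A : Type*} [Fintype ι] [DecidableEq ι] [CommRing A] (u : Finset ι → A) : A :=
  ∑ π : Finpartition (univ : Finset ι),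
    (-1 : A) ^ (#π.parts - 1) * ((#π.parts - 1).factorial : A) * ∏ B ∈ π.parts, u B

/-- The Macdonald cumulant `κ(L₁, …, L_r)(x; q, t)`, normalised by `(q - 1) ^ (r - 1)`. -/
def macdonaldCumulant {K : Type*} [Field K] (q t : K) {r : ℕ} (L : Fin r → YoungDiagram) :
    MvPowerSeries ℕ+ K :=
  ((q - 1) ^ (r - 1))⁻¹ • jointCumulant fun B => macdonald q t (oplus B L)

/-- The field `ℚ(t)`. -/
abbrev Qt : Type := RatFunc ℚ

/-- The field `ℚ(q, t)`, as the field of rational functions in `q` over `ℚ(t)`. -/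
abbrev Qqt : Type := RatFunc Qt

/-- The fully colored Macdonald polynomial of `mu`: the Macdonald cumulant of the columns of `mu`,
over `ℚ(q, t)`. (For the empty partition it is `1`.) -/
def fullyColored (mu : YoungDiagram) : MvPowerSeries ℕ+ Qqt :=
  macdonaldCumulant (RatFunc.X : Qqt) (RatFunc.C (RatFunc.X : Qt))
    fun j : Fin (mu.rowLen 0) => column (mu.colLen j)

/-- No coefficient of `f` has a pole at `q = a`. -/
def RegularAt (a : Qt) (f : MvPowerSeries ℕ+ Qqt) : Prop :=
  ∀ d, (MvPowerSeries.coeff d f).denom.eval a ≠ 0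

/-- The specialization `q = a` of the coefficients of `f`. -/
def specialize (a : Qt) (f : MvPowerSeries ℕ+ Qqt) : MvPowerSeries ℕ+ Qt :=
  fun d => RatFunc.eval (RingHom.id Qt) a (MvPowerSeries.coeff d f)

/-- A polynomial in `t` with nonnegative integer coefficients, as an element of `ℚ(t)`. -/
def ofNatPoly (p : Polynomial ℕ) : Qt :=
  algebraMap (Polynomial ℚ) Qt (p.map (Nat.castRingHom ℚ))

/-- The monomial symmetric function `m_ν`: the sum of all monomials whose multiset of nonzero
exponents is the multiset of parts of `ν`. -/
def monomialSymm {R : Type*} [CommRing R] {n : ℕ} (ν : n.Partition) : MvPowerSeries ℕ+ R :=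
  fun d => if d.support.val.map d = ν.parts then 1 else 0

/-- The finite set of sequences `i₁ ≤ ⋯ ≤ iₙ` with `i_j < i_{j+1}` for all `j ∈ D`, and with
`x_{i₁} ⋯ x_{iₙ} = x^d`. The `j`-th term is `i` at the index of value `j - 1`. -/
def fundamentalSeqs (n : ℕ) (D : Finset ℕ) (d : ℕ+ →₀ ℕ) : Finset (Fin n → ℕ+) :=
  open Classical in
  (Fintype.piFinset fun _ : Fin n => d.support).filter fun i =>
    Monotone i ∧ (∀ a b : Fin n, (b : ℕ) = a + 1 → (a : ℕ) + 1 ∈ D → i a < i b) ∧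
      ∑ a, Finsupp.single (i a) 1 = d

/-- The fundamental quasisymmetric function `F_{n,D}`, for `D ⊆ {1, …, n - 1}`. -/
def fundamental {R : Type*} [CommRing R] (n : ℕ) (D : Finset ℕ) : MvPowerSeries ℕ+ R :=
  fun d => (#(fundamentalSeqs n D d) : R)

end

end ColoredMacdonald

/-! Fix a filling of the boxes of μ. Its major index is a sum over columns and its inversion number
is a sum over pairs of columns, and neither kind of summand changes when other columns are deleted.
Hence the Macdonald polynomial of the sum of the columns in B is a series over fillings of those
columns, a product over the blocks of a set partition is a series over fillings of μ, and the
cumulant may be taken filling by filling (`coeff_cumulant_columns`). A filling σ contributes t^(maj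
σ) times the cumulant of B ↦ q^e(B), where e(B) counts the edges inside B of the multigraph on the
columns whose edges are the inversions of σ.

For such a multigraph, `cumulant_recursion` writes the cumulant of V as a sum over splittings of V
into two parts, with factors q^m - 1 = (q - 1)(1 + q + ... + q^(m-1)). By induction the cumulant is
(q - 1)^(|V|-1) times an inversion polynomial, whose value at q = -1 is nonnegative because 1 + q +
... + q^(m-1) is 0 or 1 there (`exists_inversionPoly`). The normalising power of q - 1 cancels, so
every coefficient is a polynomial in q and its value at q = -1 is a sum of nonnegative multiples of
powers of t.

The monomial expansion then only needs symmetry in the variables. By `attackInv_eq`, inv is the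
number of attacking inversions minus a quantity that depends on the descent set alone. Exchanging
two adjacent variables thus reduces to the symmetry of two-letter LLT polynomials (`jumpSum_symm`),
which is proved by widening the attack window one unit at a time.

For the fundamental expansion, the contribution of a filling depends only on its standardization in
reading order (`fillingTerm_congr`), and the fillings with a given standardization are enumerated by
a single fundamental quasisymmetric function (`card_sort_fiber`). -/

namespace ColoredMacdonald

noncomputable section

/-! ### Joint cumulants and their recursions. -/

section Cumulant

variable {ι A : Type*} [DecidableEq ι] [CommRing A]

/-- The coefficient of a set partition with `k` blocks in a joint cumulant. -/
def cumulantCoeff (A : Type*) [CommRing A] (k : ℕ) : A :=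
  (-1 : A) ^ (k - 1) * ((k - 1).factorial : A)

/-- The joint cumulant of the family `M`, restricted to the subsets of `V`. -/
def cumulant (M : Finset ι → A) (V : Finset ι) : A :=
  ∑ π : Finpartition V, cumulantCoeff A #π.parts * ∏ B ∈ π.parts, M B

/-- The set partitions of `V`, as sets of blocks. -/
def blockSets (V : Finset ι) : Finset (Finset (Finset ι)) :=
  (univ : Finset (Finpartition V)).image Finpartition.parts

theorem mem_blockSets {V : Finset ι} {P : Finset (Finset ι)} :
    P ∈ blockSets V ↔
      (∀ B ∈ P, ∀ C ∈ P, B ≠ C → Disjoint B C) ∧ P.biUnion id = V ∧ ∅ ∉ P := by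
  simp only [blockSets, mem_image, mem_univ, true_and]
  constructor
  · rintro ⟨π, rfl⟩
    refine ⟨fun B hB C hC hne => π.disjoint hB hC hne, π.biUnion_parts, π.bot_notMem⟩
  · rintro ⟨h1, h2, h3⟩
    refine ⟨⟨P, ?_, ?_, h3⟩, rfl⟩
    · rw [supIndep_iff_pairwiseDisjoint]
      exact fun B hB C hC hne => h1 B hB C hC hne
    · rw [← h2, sup_eq_biUnion]

theorem sdiff_notMem_blockSets {V B : Finset ι} {P : Finset (Finset ι)} (hP : P ∈ blockSets B)
    (hB : B ⊆ V) (hBV : B ≠ V) : V \ B ∉ P := by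
  intro hmem
  have hsub : V \ B ⊆ B := by
    rw [← (mem_blockSets.1 hP).2.1] at hmem ⊢
    exact subset_biUnion_of_mem id hmem
  exact hBV (hB.antisymm fun x hx => by
    by_contra hxB
    exact hxB (hsub (mem_sdiff.2 ⟨hx, hxB⟩)))

theorem cumulant_eq_sum_blockSets (M : Finset ι → A) (V : Finset ι) :
    cumulant M V = ∑ P ∈ blockSets V, cumulantCoeff A #P * ∏ B ∈ P, M B := by
  rw [blockSets, sum_image fun π _ ρ _ h => Finpartition.ext h]
  rfl

/-- On expanding the cumulants, a set partition with k ≥ 2 blocks appears once in the term B = V and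
k - 1 times in the others, once for each block avoiding v. The coefficients c(k) = (-1)^(k-1) (k-1)!
satisfy c(k) + (k-1) c(k-1) = 0, so only the one-block partition survives. -/
theorem moment_eq_sum_cumulant {M : Finset ι → A} (h0 : M ∅ = 1) {V : Finset ι} {v : ι}
    (hv : v ∈ V) :
    M V = ∑ B ∈ V.powerset with v ∈ B, cumulant M B * M (V \ B) := by
  -- A partition of B together with the block V \ B is a partition of V with a marked block that
  -- avoids v.
  have key : ∑ B ∈ V.powerset with v ∈ B ∧ B ≠ V, cumulant M B * M (V \ B) =
      ∑ P ∈ blockSets V, ∑ C ∈ P with v ∉ C, cumulantCoeff A (#P - 1) * ∏ B ∈ P, M B := by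
    simp only [cumulant_eq_sum_blockSets, sum_mul]
    rw [sum_sigma', sum_sigma']
    refine sum_nbij' (fun x => ⟨insert (V \ x.1) x.2, V \ x.1⟩)
      (fun x => ⟨V \ x.2, x.1.erase x.2⟩) ?_ ?_ ?_ ?_ ?_
    · rintro ⟨B, P⟩ h
      simp only [mem_sigma, mem_filter, mem_powerset, mem_blockSets] at h ⊢
      obtain ⟨⟨hB, hvB, hBV⟩, h1, h2, h3⟩ := h
      have hsub : ∀ C ∈ P, C ⊆ B := fun C hC => h2 ▸ subset_biUnion_of_mem id hC
      have hdis : ∀ C ∈ P, Disjoint C (V \ B) := fun C hC =>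
        disjoint_sdiff.mono_left (hsub C hC)
      refine ⟨⟨?_, ?_, ?_⟩, mem_insert_self _ _, ?_⟩
      · intro C hC D hD hne
        rcases mem_insert.1 hC with rfl | hC <;> rcases mem_insert.1 hD with rfl | hD
        · exact absurd rfl hne
        · exact (hdis _ hD).symm
        · exact hdis _ hC
        · exact h1 _ hC _ hD hne
      · rw [biUnion_insert, h2]
        exact sdiff_union_of_subset hB
      · rw [mem_insert, not_or]
        refine ⟨fun h => hBV (hB.antisymm ?_), h3⟩
        exact sdiff_eq_empty_iff_subset.1 h.symm
      · simp [hvB]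
    · rintro ⟨P, C⟩ h
      simp only [mem_sigma, mem_filter, mem_powerset, mem_blockSets] at h ⊢
      obtain ⟨⟨h1, h2, h3⟩, hC, hvC⟩ := h
      have hCV : C ⊆ V := h2 ▸ subset_biUnion_of_mem id hC
      refine ⟨⟨sdiff_subset, mem_sdiff.2 ⟨hv, hvC⟩, ?_⟩, ?_, ?_, ?_⟩
      · intro h
        have : C = ∅ := by
          rw [← disjoint_self_iff_empty]
          exact ((Finset.sdiff_eq_self_iff_disjoint.1 h).mono_left hCV).symm
        exact h3 (this ▸ hC)
      · exact fun B hB D hD hne => h1 B (mem_of_mem_erase hB) D (mem_of_mem_erase hD) hne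
      · ext x
        simp only [mem_biUnion, mem_erase, id, mem_sdiff, ← h2]
        constructor
        · rintro ⟨B, ⟨hne, hB⟩, hx⟩
          exact ⟨⟨B, hB, hx⟩, fun hxC => disjoint_left.1 (h1 B hB C hC hne) hx hxC⟩
        · rintro ⟨⟨B, hB, hx⟩, hxC⟩
          exact ⟨B, ⟨fun h => hxC (h ▸ hx), hB⟩, hx⟩
      · exact fun h => h3 (mem_of_mem_erase h)
    · rintro ⟨B, P⟩ h
      simp only [mem_sigma, mem_filter, mem_powerset, mem_blockSets] at h ⊢
      obtain ⟨⟨hB, hvB, hBV⟩, h1, h2, h3⟩ := h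
      have hne := sdiff_notMem_blockSets (mem_blockSets.2 ⟨h1, h2, h3⟩) hB hBV
      simp only [Finset.sdiff_sdiff_eq_self hB, erase_insert hne]
    · rintro ⟨P, C⟩ h
      simp only [mem_sigma, mem_filter, mem_blockSets] at h ⊢
      obtain ⟨⟨h1, h2, h3⟩, hC, hvC⟩ := h
      have hCV : C ⊆ V := h2 ▸ subset_biUnion_of_mem id hC
      simp only [Finset.sdiff_sdiff_eq_self hCV, insert_erase hC]
    · rintro ⟨B, P⟩ h
      simp only [mem_sigma, mem_filter, mem_powerset, mem_blockSets] at h ⊢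
      obtain ⟨⟨hB, hvB, hBV⟩, h1, h2, h3⟩ := h
      have hne := sdiff_notMem_blockSets (mem_blockSets.2 ⟨h1, h2, h3⟩) hB hBV
      rw [card_insert_of_notMem hne, prod_insert hne]
      simp only [Nat.add_sub_cancel]
      ring
  have split : ∑ B ∈ V.powerset with v ∈ B, cumulant M B * M (V \ B) =
      cumulant M V + ∑ B ∈ V.powerset with v ∈ B ∧ B ≠ V, cumulant M B * M (V \ B) := by
    have hmem : V ∈ V.powerset.filter (v ∈ ·) := by simp [hv]
    rw [← add_sum_erase _ _ hmem, sdiff_self, bot_eq_empty, h0, mul_one]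
    congr 2
    ext B
    simp only [mem_erase, mem_filter]
    tauto
  rw [split, key, cumulant_eq_sum_blockSets, ← sum_add_distrib]
  have hone : ({V} : Finset (Finset ι)) ∈ blockSets V := by
    rw [mem_blockSets]
    refine ⟨?_, by simp, ?_⟩
    · simp only [mem_singleton]
      rintro B rfl C rfl h
      exact absurd rfl h
    · rw [mem_singleton]
      rintro rfl
      simp at hv
  rw [sum_eq_single_of_mem _ hone]
  · simp [cumulantCoeff, filter_singleton, hv]
  · intro P hP hne
    have hP' := hP
    obtain ⟨h1, h2, h3⟩ := mem_blockSets.1 hP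
    obtain ⟨C, hC, hvC⟩ : ∃ C ∈ P, v ∈ C := by
      rw [← h2, mem_biUnion] at hv
      exact hv
    have hf : P.filter (v ∉ ·) = P.erase C := by
      ext B
      simp only [mem_filter, mem_erase]
      constructor
      · rintro ⟨hB, hvB⟩
        exact ⟨fun h => hvB (h ▸ hvC), hB⟩
      · rintro ⟨hBC, hB⟩
        exact ⟨hB, fun hvB => disjoint_left.1 (h1 B hB C hC hBC) hvB hvC⟩
    rw [hf, sum_const, card_erase_of_mem hC]
    have hcard : 2 ≤ #P := by
      by_contra hlt
      have hpos : 0 < #P := card_pos.2 ⟨C, hC⟩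
      obtain ⟨D, hD⟩ := card_eq_one.1 (show #P = 1 by omega)
      subst hD
      simp only [singleton_biUnion, id] at h2
      exact hne (by rw [h2])
    obtain ⟨k, hk⟩ := Nat.exists_eq_add_of_le hcard
    rw [hk]
    have e1 : 2 + k - 1 = k + 1 := by omega
    simp only [cumulantCoeff, e1, Nat.add_sub_cancel, nsmul_eq_mul, Nat.factorial_succ]
    push_cast
    ring

/-- Write X for the right-hand side. The moment M V is computed in two ways: by splitting off the
blocks of v and w, and by first removing v through `hM`. With X already known to equal the cumulant
on smaller sets, the two results differ exactly by cumulant M V - X V. -/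
theorem cumulant_recursion {M : Finset ι → A} (h0 : M ∅ = 1) {v w : ι} (hvw : v ≠ w)
    {Q : Finset ι → A} (hQ : ∀ B C, Disjoint B C → Q (B ∪ C) = Q B * Q C)
    (hM : ∀ B, v ∉ B → M (insert v B) = Q B * M B) (V : Finset ι) (hv : v ∈ V) (hw : w ∈ V) :
    cumulant M V =
      ∑ B ∈ V.powerset with v ∉ B ∧ w ∈ B, (Q B - 1) * cumulant M B * cumulant M (V \ B) := by
  induction V using Finset.strongInduction with
  | H V ih =>
  set X : Finset ι → A := fun V =>
    ∑ B ∈ V.powerset with v ∉ B ∧ w ∈ B, (Q B - 1) * cumulant M B * cumulant M (V \ B) with hX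
  have hswap : ∀ f : Finset ι → Finset ι → A,
      ∑ B ∈ V.powerset with v ∈ B ∧ w ∈ B, ∑ C ∈ B.powerset with v ∉ C ∧ w ∈ C, f C (B \ C) =
      ∑ C ∈ V.powerset with v ∉ C ∧ w ∈ C, ∑ B ∈ (V \ C).powerset with v ∈ B, f C B := by
    intro f
    rw [sum_sigma', sum_sigma']
    refine sum_nbij' (fun x => ⟨x.2, x.1 \ x.2⟩) (fun x => ⟨x.1 ∪ x.2, x.1⟩) ?_ ?_ ?_ ?_ ?_
    · rintro ⟨B, C⟩ h
      simp only [mem_sigma, mem_filter, mem_powerset, mem_sdiff] at h ⊢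
      exact ⟨⟨h.2.1.trans h.1.1, h.2.2⟩, sdiff_subset_sdiff h.1.1 subset_rfl, h.1.2.1, h.2.2.1⟩
    · rintro ⟨C, B⟩ h
      simp only [mem_sigma, mem_filter, mem_powerset, mem_union] at h ⊢
      exact ⟨⟨union_subset h.1.1 (h.2.1.trans sdiff_subset), Or.inr h.2.2, Or.inl h.1.2.2⟩,
        subset_union_left, h.1.2⟩
    · rintro ⟨B, C⟩ h
      simp only [mem_sigma, mem_filter, mem_powerset] at h
      simp only [union_sdiff_of_subset h.2.1]
    · rintro ⟨C, B⟩ h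
      simp only [mem_sigma, mem_filter, mem_powerset] at h
      have : Disjoint C B := disjoint_sdiff.mono_right h.2.1
      simp only [union_sdiff_cancel_left this]
    · rintro ⟨B, C⟩ h
      rfl
  -- If the block of v misses w, the block C of w is split off as well; the double sum is then
  -- folded back over the block of v.
  have h1 : M V = ∑ B ∈ V.powerset with v ∈ B ∧ w ∈ B, cumulant M B * M (V \ B) +
      ∑ C ∈ V.powerset with v ∉ C ∧ w ∈ C, cumulant M C * M (V \ C) := by
    rw [moment_eq_sum_cumulant h0 hv, ← sum_filter_add_sum_filter_not _ (w ∈ ·), filter_filter,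
      filter_filter]
    congr 1
    have e1 : ∀ B ∈ V.powerset.filter (fun B => v ∈ B ∧ w ∉ B), cumulant M B * M (V \ B) =
        ∑ C ∈ (V \ B).powerset with w ∈ C, cumulant M B * cumulant M C * M (V \ (B ∪ C)) := by
      intro B hB
      rw [mem_filter] at hB
      rw [moment_eq_sum_cumulant h0 (mem_sdiff.2 ⟨hw, hB.2.2⟩), mul_sum]
      refine sum_congr rfl fun C _ => ?_
      rw [mul_assoc, sdiff_sdiff_left]
      rfl
    have e2 : ∀ C ∈ V.powerset.filter (fun B => v ∉ B ∧ w ∈ B), cumulant M C * M (V \ C) =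
        ∑ B ∈ (V \ C).powerset with v ∈ B, cumulant M B * cumulant M C * M (V \ (B ∪ C)) := by
      intro C hC
      rw [mem_filter] at hC
      rw [moment_eq_sum_cumulant h0 (mem_sdiff.2 ⟨hv, hC.2.1⟩), mul_sum]
      refine sum_congr rfl fun B _ => ?_
      rw [union_comm, sdiff_sdiff_left]
      simp only [sup_eq_union]
      ring
    rw [sum_congr rfl e1, sum_congr rfl e2]
    refine sum_comm' fun B C => ?_
    simp only [mem_filter, mem_powerset, subset_sdiff]
    constructor
    · rintro ⟨⟨h1, h2, h3⟩, ⟨h4, h5⟩, h6⟩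
      exact ⟨⟨⟨h1, h5.symm⟩, h2⟩, h4, disjoint_left.1 h5.symm h2, h6⟩
    · rintro ⟨⟨⟨h1, h2⟩, h3⟩, h4, h5, h6⟩
      exact ⟨⟨h1, h3, disjoint_left.1 h2.symm h6⟩, ⟨h4, h2.symm⟩, h6⟩
  have h2 : ∑ B ∈ V.powerset with v ∈ B ∧ w ∈ B, X B * M (V \ B) =
      ∑ C ∈ V.powerset with v ∉ C ∧ w ∈ C, (Q C - 1) * cumulant M C * M (V \ C) := by
    have := hswap fun C D => (Q C - 1) * cumulant M C * cumulant M D * M (V \ (C ∪ D))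
    rw [← sub_eq_zero] at this ⊢
    rw [← this]
    congr 1
    · refine sum_congr rfl fun B hB => ?_
      rw [sum_mul]
      refine sum_congr rfl fun C hC => ?_
      simp only [mem_filter, mem_powerset] at hC
      rw [union_sdiff_of_subset hC.1]
    · refine sum_congr rfl fun C hC => ?_
      simp only [mem_filter, mem_powerset] at hC
      rw [moment_eq_sum_cumulant h0 (mem_sdiff.2 ⟨hv, hC.2.1⟩), mul_sum]
      refine sum_congr rfl fun B _ => ?_
      rw [sdiff_sdiff_left, mul_assoc ((Q C - 1) * cumulant M C)]
      rfl
  have h3 : ∑ B ∈ V.powerset with v ∈ B ∧ w ∈ B, cumulant M B * M (V \ B) =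
      (cumulant M V - X V) + ∑ B ∈ V.powerset with v ∈ B ∧ w ∈ B, X B * M (V \ B) := by
    rw [← sub_eq_iff_eq_add, ← sum_sub_distrib]
    rw [sum_eq_single_of_mem V (by simp [hv, hw])]
    · rw [sdiff_self, bot_eq_empty, h0]
      ring
    · intro B hB hne
      simp only [mem_filter, mem_powerset] at hB
      rw [ih B (hB.1.ssubset_of_ne hne) hB.2.1 hB.2.2, sub_self]
  -- With V = W ∪ {v}, M V = Q W * M W; expand M W at w, factor Q W = Q C * Q (W \ C), and reabsorb
  -- v into W \ C.
  have h4 : ∑ C ∈ V.powerset with v ∉ C ∧ w ∈ C, Q C * cumulant M C * M (V \ C) = M V := by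
    obtain ⟨W, hvW, rfl⟩ : ∃ W, v ∉ W ∧ insert v W = V := ⟨V.erase v, by simp, insert_erase hv⟩
    have hwW : w ∈ W := (mem_insert.1 hw).resolve_left hvw.symm
    rw [hM W hvW, moment_eq_sum_cumulant h0 hwW, mul_sum]
    have hset : (insert v W).powerset.filter (fun C => v ∉ C ∧ w ∈ C) =
        W.powerset.filter (w ∈ ·) := by
      ext C
      simp only [mem_filter, mem_powerset]
      constructor
      · rintro ⟨h1, h2, h3⟩
        exact ⟨(subset_insert_iff_of_notMem h2).1 h1, h3⟩
      · rintro ⟨h1, h2⟩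
        exact ⟨h1.trans (subset_insert _ _), fun h => hvW (h1 h), h2⟩
    rw [hset]
    refine sum_congr rfl fun C hC => ?_
    simp only [mem_filter, mem_powerset] at hC
    have hvC : v ∉ C := fun h => hvW (hC.1 h)
    rw [insert_sdiff_of_notMem _ hvC, hM _ (fun h => hvW (mem_sdiff.1 h).1)]
    conv_rhs => rw [← union_sdiff_of_subset hC.1, hQ _ _ disjoint_sdiff]
    rw [union_sdiff_of_subset hC.1]
    ring
  rw [h3, h2, ← h4, add_assoc, ← sum_add_distrib] at h1
  have h5 : ∀ C, (Q C - 1) * cumulant M C * M (V \ C) + cumulant M C * M (V \ C) =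
      Q C * cumulant M C * M (V \ C) := fun C => by ring
  simp only [h5] at h1
  exact sub_eq_zero.1 (left_eq_add.1 (h1.trans (add_comm _ _)))

theorem cumulant_empty (M : Finset ι → A) : cumulant M ∅ = 1 := by
  have : blockSets (∅ : Finset ι) = {∅} := by
    ext P
    rw [mem_blockSets, mem_singleton]
    constructor
    · rintro ⟨-, h2, h3⟩
      refine eq_empty_of_forall_notMem fun B hB => h3 ?_
      have hsub : B ⊆ ∅ := h2 ▸ subset_biUnion_of_mem id hB
      exact subset_empty.1 hsub ▸ hB
    · rintro rfl
      simp
  simp [cumulant_eq_sum_blockSets, this, cumulantCoeff]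

theorem map_cumulant {A' : Type*} [CommRing A'] (f : A →+* A') (M : Finset ι → A)
    (V : Finset ι) : f (cumulant M V) = cumulant (fun B => f (M B)) V := by
  simp [cumulant, cumulantCoeff, map_sum, map_prod]

theorem cumulant_singleton (M : Finset ι → A) (h0 : M ∅ = 1) (v : ι) :
    cumulant M {v} = M {v} := by
  rw [moment_eq_sum_cumulant h0 (mem_singleton_self v)]
  have : ({v} : Finset ι).powerset.filter (v ∈ ·) = {{v}} := by
    ext B
    simp only [mem_filter, mem_powerset, subset_singleton_iff, mem_singleton]
    constructor
    · rintro ⟨rfl | rfl, h⟩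
      · simp at h
      · rfl
    · rintro rfl
      simp
  rw [this, sum_singleton, sdiff_self, bot_eq_empty, h0, mul_one]

end Cumulant

/-! ### Inversion polynomials of multigraphs. -/

section Inversion

open Polynomial

variable {ι : Type*} [LinearOrder ι]

/-- The number of edges inside `V` of the multigraph with `e i j` edges between `i < j`. -/
def edgeCount (e : ι → ι → ℕ) (V : Finset ι) : ℕ :=
  ∑ p ∈ V ×ˢ V with p.1 < p.2, e p.1 p.2

/-- The number of edges between `v` and `B`. -/
def edgeCountTo (e : ι → ι → ℕ) (v : ι) (B : Finset ι) : ℕ :=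
  ∑ j ∈ B, if v < j then e v j else e j v

theorem edgeCount_insert (e : ι → ι → ℕ) {v : ι} {B : Finset ι} (hv : v ∉ B) :
    edgeCount e (insert v B) = edgeCountTo e v B + edgeCount e B := by
  simp only [edgeCount, edgeCountTo, sum_filter, sum_product]
  rw [sum_insert hv, sum_insert hv]
  simp only [lt_irrefl, if_false, zero_add]
  have : ∀ i ∈ B, (∑ j ∈ insert v B, if i < j then e i j else 0) =
      (if i < v then e i v else 0) + ∑ j ∈ B, if i < j then e i j else 0 :=
    fun i _ => sum_insert hv
  rw [sum_congr rfl this, sum_add_distrib, ← add_assoc, ← sum_add_distrib]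
  congr 1
  refine sum_congr rfl fun j hj => ?_
  rcases lt_trichotomy v j with h | rfl | h
  · simp [h, h.not_gt]
  · exact absurd hj hv
  · simp [h, h.not_gt]

/-- Multigraph inversion polynomials: the cumulants of `B ↦ q ^ e(B)` are divisible by
`(q - 1) ^ (|V| - 1)`, and the value of the quotient at `q = -1` is nonnegative. -/
theorem exists_inversionPoly (e : ι → ι → ℕ) (V : Finset ι) :
    ∃ p : ℤ[X], cumulant (fun B => (X : ℤ[X]) ^ edgeCount e B) V = (X - 1) ^ (#V - 1) * p ∧
      0 ≤ p.eval (-1) := by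
  rcases V.eq_empty_or_nonempty with rfl | hV
  · exact ⟨1, by rw [cumulant_empty]; simp, by simp⟩
  set M : Finset ι → ℤ[X] := fun B => (X : ℤ[X]) ^ edgeCount e B with hM
  have h0 : M ∅ = 1 := by simp [hM, edgeCount]
  induction V using Finset.strongInduction with
  | H V ih =>
  obtain ⟨v, hv⟩ := hV
  by_cases hw : ∃ w ∈ V, v ≠ w
  · obtain ⟨w, hw, hvw⟩ := hw
    have hrec := cumulant_recursion h0 hvw (Q := fun B => (X : ℤ[X]) ^ edgeCountTo e v B)
      (fun B C h => by rw [edgeCountTo, sum_union h, pow_add]; rfl)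
      (fun B h => by simp only [hM]; rw [edgeCount_insert e h, pow_add]) V hv hw
    have hex : ∀ B ∈ V.powerset.filter (fun B => v ∉ B ∧ w ∈ B), ∃ p : ℤ[X],
        ((X : ℤ[X]) ^ edgeCountTo e v B - 1) * cumulant M B * cumulant M (V \ B) =
          (X - 1) ^ (#V - 1) * p ∧ 0 ≤ p.eval (-1) := by
      intro B hB
      simp only [mem_filter, mem_powerset] at hB
      obtain ⟨hBV, hvB, hwB⟩ := hB
      obtain ⟨p, hp, hp0⟩ := ih B (hBV.ssubset_of_ne fun h => hvB (h ▸ hv)) ⟨w, hwB⟩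
      obtain ⟨p', hp', hp0'⟩ := ih (V \ B)
        ((sdiff_subset).ssubset_of_ne fun h => (mem_sdiff.1 (h.symm ▸ hw)).2 hwB)
        ⟨v, mem_sdiff.2 ⟨hv, hvB⟩⟩
      -- The factor X^m - 1 supplies one extra X - 1 and a geometric sum; the two parts supply |B| -
      -- 1 and |V \ B| - 1 more, |V| - 1 in all. The geometric sum at -1 is 0 or 1.
      refine ⟨(∑ i ∈ range (edgeCountTo e v B), X ^ i) * p * p', ?_, ?_⟩
      · rw [hp, hp', ← mul_geom_sum]
        have h1 : 0 < #B := card_pos.2 ⟨w, hwB⟩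
        have h2 : 0 < #(V \ B) := card_pos.2 ⟨v, mem_sdiff.2 ⟨hv, hvB⟩⟩
        have h3 : #(V \ B) + #B = #V := card_sdiff_add_card_eq_card hBV
        have h4 : #V - 1 = 1 + (#B - 1) + (#(V \ B) - 1) := by omega
        rw [h4, pow_add, pow_add]
        ring
      · rw [eval_mul, eval_mul]
        refine mul_nonneg (mul_nonneg ?_ hp0) hp0'
        rw [eval_finsetSum]
        simp only [eval_pow, eval_X]
        rw [neg_one_geom_sum]
        split_ifs <;> norm_num
    choose! f hf hf0 using hex
    refine ⟨∑ B ∈ V.powerset with v ∉ B ∧ w ∈ B, f B, ?_, ?_⟩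
    · rw [hrec, mul_sum]
      exact sum_congr rfl hf
    · rw [eval_finsetSum]
      exact sum_nonneg hf0
  · push Not at hw
    have hVv : V = {v} := eq_singleton_iff_unique_mem.2 ⟨hv, fun x hx => (hw x hx).symm⟩
    subst hVv
    refine ⟨1, ?_, by simp⟩
    rw [cumulant_singleton M h0]
    simp [hM, edgeCount, filter_singleton]

end Inversion

/-! ### Symmetry of two-letter LLT sums. -/

section TwoLetters

variable {α R : Type*} [DecidableEq α] [CommRing R]

/-- Number of attacking pairs from `A` to `B`, where `u` attacks `v` if `0 < pos v - pos u < w`. -/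
def attacks (pos : α → ℤ) (w : ℤ) (A B : Finset α) : ℕ :=
  #{p ∈ A ×ˢ B | 0 < pos p.2 - pos p.1 ∧ pos p.2 - pos p.1 < w}

/-- The elements `u` of `A` such that some element of `B` has position `pos u + w`. -/
def jumps (pos : α → ℤ) (w : ℤ) (A B : Finset α) : Finset α :=
  {u ∈ A | ∃ v ∈ B, pos v = pos u + w}

/-- Generating polynomial of the subsets `A` of `S` with `a` elements and given set of jumps from
`A` to its complement. -/
def jumpSum (q : R) (pos : α → ℤ) (w : ℤ) (S D : Finset α) (a : ℕ) : R :=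
  ∑ A ∈ S.powersetCard a with jumps pos w A (S \ A) = D, q ^ attacks pos w A (S \ A)

theorem attacks_insert_left (pos : α → ℤ) (w : ℤ) {u : α} {A : Finset α} (hu : u ∉ A)
    (B : Finset α) :
    attacks pos w (insert u A) B =
      #{v ∈ B | 0 < pos v - pos u ∧ pos v - pos u < w} + attacks pos w A B := by
  simp only [attacks, card_filter, sum_product]
  rw [sum_insert hu]

theorem attacks_insert_right (pos : α → ℤ) (w : ℤ) {v : α} {B : Finset α} (hv : v ∉ B)
    (A : Finset α) :
    attacks pos w A (insert v B) =
      #{u ∈ A | 0 < pos v - pos u ∧ pos v - pos u < w} + attacks pos w A B := by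
  simp only [attacks, card_filter, sum_product]
  rw [← sum_add_distrib]
  exact sum_congr rfl fun u _ => sum_insert hv

/-- The wider window admits just the pairs at distance exactly w, and by injectivity each jump has a
single partner. -/
theorem attacks_add_one {pos : α → ℤ} (hpos : pos.Injective) {w : ℤ} (hw : 0 < w)
    (A B : Finset α) :
    attacks pos (w + 1) A B = attacks pos w A B + #(jumps pos w A B) := by
  simp only [attacks, jumps, card_filter, sum_product]
  rw [← sum_add_distrib]
  refine sum_congr rfl fun u _ => ?_
  by_cases h : ∃ v ∈ B, pos v = pos u + w
  · obtain ⟨v, hv, huv⟩ := h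
    rw [if_pos ⟨v, hv, huv⟩, ← add_sum_erase _ _ hv, ← add_sum_erase B _ hv, if_pos (by omega),
      if_neg (by omega), zero_add, add_comm]
    congr 1
    refine sum_congr rfl fun x hx => if_congr ?_ rfl rfl
    have : pos x ≠ pos v := fun h => (mem_erase.1 hx).1 (hpos h)
    omega
  · rw [if_neg h, add_zero]
    push Not at h
    refine sum_congr rfl fun x hx => if_congr ?_ rfl rfl
    have := h x hx
    omega

theorem sum_pow_attacks_eq_sum_jumpSum (q : R) (pos : α → ℤ) (w : ℤ) (S : Finset α) (a : ℕ) :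
    ∑ A ∈ S.powersetCard a, q ^ attacks pos w A (S \ A) =
      ∑ D ∈ S.powerset, jumpSum q pos w S D a := by
  simp only [jumpSum]
  refine (sum_fiberwise_of_maps_to (fun A hA => ?_) _).symm
  exact mem_powerset.2 ((filter_subset _ _).trans (mem_powersetCard.1 hA).1)

theorem sum_pow_attacks_add_one_eq_sum_jumpSum (q : R) {pos : α → ℤ} (hpos : pos.Injective)
    {w : ℤ} (hw : 0 < w) (S : Finset α) (a : ℕ) :
    ∑ A ∈ S.powersetCard a, q ^ attacks pos (w + 1) A (S \ A) =
      ∑ D ∈ S.powerset, q ^ #D * jumpSum q pos w S D a := by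
  simp only [jumpSum, mul_sum]
  rw [← sum_fiberwise_of_maps_to (g := fun A => jumps pos w A (S \ A)) (t := S.powerset)
    (fun A hA => mem_powerset.2 ((filter_subset _ _).trans (mem_powersetCard.1 hA).1))]
  refine sum_congr rfl fun D _ => sum_congr rfl fun A hA => ?_
  rw [attacks_add_one hpos hw, (mem_filter.1 hA).2, pow_add, mul_comm]

theorem jumps_insert_insert {pos : α → ℤ} (hpos : pos.Injective) {w : ℤ} {u u' : α}
    (huu : pos u' = pos u + w) {A B : Finset α} (hA : u ∉ A) :
    jumps pos w (insert u A) (insert u' B) = insert u (jumps pos w A B) := by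
  ext x
  simp only [jumps, mem_filter, mem_insert]
  constructor
  · rintro ⟨rfl | hx, h⟩
    · exact Or.inl rfl
    · obtain ⟨v, rfl | hv, hvx⟩ := h
      · have : x = u := hpos (by omega)
        exact absurd (this ▸ hx) hA
      · exact Or.inr ⟨hx, v, hv, hvx⟩
  · rintro (rfl | ⟨hx, v, hv, hvx⟩)
    · exact ⟨Or.inl rfl, u', Or.inl rfl, huu⟩
    · exact ⟨Or.inr hx, v, Or.inr hv, hvx⟩

/-- Removing a jump, with both its ends, changes the number of attacks by a constant. -/
theorem jumpSum_remove (q : R) {pos : α → ℤ} (hpos : pos.Injective) {w : ℤ} (hw : 0 < w)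
    {S D : Finset α} {u u' : α} (hu : u ∈ S) (hu' : u' ∈ S) (huu : pos u' = pos u + w)
    (huD : u ∈ D) (a : ℕ) :
    jumpSum q pos w S D (a + 1) =
      q ^ #{v ∈ (S.erase u).erase u' | 0 < pos v - pos u ∧ pos v - pos u < w} *
        jumpSum q pos w ((S.erase u).erase u') (D.erase u) a := by
  have hne : u ≠ u' := by rintro rfl; omega
  rw [jumpSum, jumpSum, mul_sum]
  set S' := (S.erase u).erase u' with hS'
  have huS' : u ∉ S' := by simp [hS']
  have hu'S' : u' ∉ S' := by simp [hS']
  have hcompl : ∀ A ⊆ S', S \ insert u A = insert u' (S' \ A) := by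
    intro A hA
    ext x
    simp only [mem_sdiff, mem_insert, hS', mem_erase, not_or]
    constructor
    · rintro ⟨hx, hxu, hxA⟩
      by_cases h : x = u'
      · exact Or.inl h
      · exact Or.inr ⟨⟨h, hxu, hx⟩, hxA⟩
    · rintro (rfl | ⟨⟨h1, h2, h3⟩, h4⟩)
      · exact ⟨hu', hne.symm, fun h => hu'S' (hA h)⟩
      · exact ⟨h3, h2, h4⟩
  refine sum_nbij' (fun A => A.erase u) (fun A => insert u A) ?_ ?_ ?_ ?_ ?_
  · intro A hA
    simp only [mem_filter, mem_powersetCard] at hA ⊢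
    obtain ⟨⟨hAS, hcard⟩, hj⟩ := hA
    have huA : u ∈ jumps pos w A (S \ A) := hj ▸ huD
    obtain ⟨huA, v, hv, hvu⟩ := mem_filter.1 huA
    have hvu' : v = u' := hpos (by omega)
    subst hvu'
    have hsub : A.erase u ⊆ S' := fun x hx =>
      mem_erase.2 ⟨fun h => (mem_sdiff.1 hv).2 (h ▸ (mem_erase.1 hx).2),
        mem_erase.2 ⟨(mem_erase.1 hx).1, hAS (mem_erase.1 hx).2⟩⟩
    refine ⟨⟨hsub, by rw [card_erase_of_mem huA, hcard, Nat.add_sub_cancel]⟩, ?_⟩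
    have h2 := hcompl _ hsub
    rw [insert_erase huA] at h2
    have h3 := jumps_insert_insert hpos huu (B := S' \ A.erase u) (notMem_erase u A)
    rw [insert_erase huA, ← h2, hj] at h3
    rw [h3, erase_insert]
    exact fun h => notMem_erase u A (mem_filter.1 h).1
  · intro A hA
    simp only [mem_filter, mem_powersetCard] at hA ⊢
    obtain ⟨⟨hAS, hcard⟩, hj⟩ := hA
    have huA : u ∉ A := fun h => huS' (hAS h)
    refine ⟨⟨insert_subset hu fun x hx => mem_of_mem_erase (mem_of_mem_erase (hAS hx)), ?_⟩, ?_⟩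
    · rw [card_insert_of_notMem huA, hcard]
    · rw [hcompl A hAS, jumps_insert_insert hpos huu huA, hj, insert_erase huD]
  · intro A hA
    simp only [mem_filter, mem_powersetCard] at hA
    have huA : u ∈ jumps pos w A (S \ A) := hA.2 ▸ huD
    exact insert_erase (mem_filter.1 huA).1
  · intro A hA
    simp only [mem_filter, mem_powersetCard] at hA
    exact erase_insert fun h => huS' (hA.1.1 h)
  · intro A hA
    simp only [mem_filter, mem_powersetCard] at hA
    obtain ⟨⟨hAS, hcard⟩, hj⟩ := hA
    have huA : u ∈ jumps pos w A (S \ A) := hj ▸ huD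
    obtain ⟨huA, v, hv, hvu⟩ := mem_filter.1 huA
    have hvu' : v = u' := hpos (by omega)
    subst hvu'
    have hsub : A.erase u ⊆ S' := fun x hx =>
      mem_erase.2 ⟨fun h => (mem_sdiff.1 hv).2 (h ▸ (mem_erase.1 hx).2),
        mem_erase.2 ⟨(mem_erase.1 hx).1, hAS (mem_erase.1 hx).2⟩⟩
    rw [← pow_add]
    congr 1
    have h2 := hcompl _ hsub
    have hvn : v ∉ S' \ A.erase u := fun h => hu'S' (mem_sdiff.1 h).1
    conv_lhs => rw [← insert_erase huA, h2, attacks_insert_left _ _ (notMem_erase u A),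
      attacks_insert_right _ _ hvn, filter_insert, if_neg (by omega), ← add_assoc]
    congr 1
    -- An element strictly between u and its partner at distance w is attacked by u if it lies
    -- outside A, and attacks the partner if it lies in A. Either way it counts once, so the total
    -- does not depend on A.
    have h5 : S' = (S' \ A.erase u) ∪ A.erase u := (sdiff_union_of_subset hsub).symm
    conv_rhs => rw [h5, filter_union, card_union_of_disjoint
      (disjoint_filter_filter sdiff_disjoint)]
    congr 2
    refine filter_congr fun x _ => ?_
    omega

theorem jumpSum_eq_zero (q : R) {pos : α → ℤ} {w : ℤ}
    {S D : Finset α} {u : α} (huD : u ∈ D) (h : ¬ (u ∈ S ∧ ∃ v ∈ S, pos v = pos u + w)) (a : ℕ) :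
    jumpSum q pos w S D a = 0 := by
  rw [jumpSum, sum_eq_zero]
  intro A hA
  simp only [mem_filter, mem_powersetCard] at hA
  have huA : u ∈ jumps pos w A (S \ A) := hA.2 ▸ huD
  obtain ⟨huA, v, hv, hvu⟩ := mem_filter.1 huA
  exact absurd ⟨hA.1.1 huA, v, (mem_sdiff.1 hv).1, hvu⟩ h

theorem jumpSum_zero_of_mem (q : R) {pos : α → ℤ} {w : ℤ}
    {S D : Finset α} {u : α} (huD : u ∈ D) : jumpSum q pos w S D 0 = 0 := by
  rw [jumpSum, sum_eq_zero]
  intro A hA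
  simp only [mem_filter, mem_powersetCard, card_eq_zero] at hA
  have huA : u ∈ jumps pos w A (S \ A) := hA.2 ▸ huD
  rw [hA.1.2] at huA
  exact absurd (mem_filter.1 huA).1 (notMem_empty u)

theorem jumpSum_card_of_mem (q : R) {pos : α → ℤ} {w : ℤ}
    {S D : Finset α} {u : α} (huD : u ∈ D) : jumpSum q pos w S D #S = 0 := by
  rw [jumpSum, sum_eq_zero]
  intro A hA
  simp only [mem_filter, mem_powersetCard] at hA
  have huA : u ∈ jumps pos w A (S \ A) := hA.2 ▸ huD
  rw [eq_of_subset_of_card_le hA.1.1 hA.1.2.ge, sdiff_self] at huA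
  obtain ⟨_, v, hv, _⟩ := mem_filter.1 huA
  exact absurd hv (notMem_empty v)

/-- Induction on the size of S. A prescribed jump can be removed with both its ends, which takes one
element from each of A and its complement and so preserves the condition a + b = #S. The case of no
jumps is what remains of `hU`. -/
theorem jumpSum_symm_of_sum_symm (q : R) {pos : α → ℤ} (hpos : pos.Injective) {w : ℤ}
    (hw : 0 < w)
    (hU : ∀ (S : Finset α) (a b : ℕ), a + b = #S →
      ∑ A ∈ S.powersetCard a, q ^ attacks pos w A (S \ A) =
        ∑ A ∈ S.powersetCard b, q ^ attacks pos w A (S \ A))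
    (S D : Finset α) (a b : ℕ) (hab : a + b = #S) :
    jumpSum q pos w S D a = jumpSum q pos w S D b := by
  induction hn : #S using Nat.strong_induction_on generalizing S D a b with
  | _ n ih =>
  subst hn
  have hne : ∀ D : Finset α, D.Nonempty → jumpSum q pos w S D a = jumpSum q pos w S D b := by
    rintro D ⟨u, huD⟩
    by_cases h : u ∈ S ∧ ∃ v ∈ S, pos v = pos u + w
    · obtain ⟨hu, u', hu', huu⟩ := h
      rcases a with _ | a
      · rw [jumpSum_zero_of_mem q huD, show b = #S by omega, jumpSum_card_of_mem q huD]
      rcases b with _ | b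
      · rw [jumpSum_zero_of_mem q huD, show a + 1 = #S by omega, jumpSum_card_of_mem q huD]
      have hmem : u' ∈ S.erase u := mem_erase.2 ⟨by rintro rfl; omega, hu'⟩
      have hc : #((S.erase u).erase u') = #S - 1 - 1 := by
        rw [card_erase_of_mem hmem, card_erase_of_mem hu]
      rw [jumpSum_remove q hpos hw hu hu' huu huD, jumpSum_remove q hpos hw hu hu' huu huD,
        ih _ (by omega) _ _ a b (by omega) rfl]
    · rw [jumpSum_eq_zero q huD h, jumpSum_eq_zero q huD h]
  rcases D.eq_empty_or_nonempty with rfl | hD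
  · have h := hU S a b hab
    rw [sum_pow_attacks_eq_sum_jumpSum, sum_pow_attacks_eq_sum_jumpSum,
      ← add_sum_erase _ _ (empty_mem_powerset S), ← add_sum_erase _ _ (empty_mem_powerset S)] at h
    rw [sum_congr rfl fun D hD => hne D (nonempty_iff_ne_empty.2 (mem_erase.1 hD).1)] at h
    exact add_right_cancel h
  · exact hne D hD

/-- Window 1 has no attacks, which leaves the symmetry of binomial coefficients. Symmetry for one
window refines to each jump set, and widening the window weights a jump set D by q^|D|, the same on
both sides. -/
theorem sum_pow_attacks_symm (q : R) {pos : α → ℤ} (hpos : pos.Injective) (w : ℕ)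
    (S : Finset α) (a b : ℕ) (hab : a + b = #S) :
    ∑ A ∈ S.powersetCard a, q ^ attacks pos (w + 1) A (S \ A) =
      ∑ A ∈ S.powersetCard b, q ^ attacks pos (w + 1) A (S \ A) := by
  induction w generalizing S a b with
  | zero =>
    have h0 : ∀ A B : Finset α, attacks pos (((0 : ℕ) : ℤ) + 1) A B = 0 := by
      intro A B
      rw [attacks, card_eq_zero, filter_eq_empty_iff]
      intro p _
      push_cast
      omega
    simp only [h0, pow_zero, sum_const, card_powersetCard]
    rw [Nat.choose_symm_of_eq_add (by omega : #S = a + b)]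
  | succ w ih =>
    push_cast
    rw [sum_pow_attacks_add_one_eq_sum_jumpSum q hpos (by omega),
      sum_pow_attacks_add_one_eq_sum_jumpSum q hpos (by omega)]
    refine sum_congr rfl fun D _ => ?_
    rw [jumpSum_symm_of_sum_symm q hpos (by omega) ih S D a b hab]

/-- Symmetry of two-letter vertical-strip LLT polynomials. -/
theorem jumpSum_symm (q : R) {pos : α → ℤ} (hpos : pos.Injective) {w : ℕ} (hw : 0 < w)
    (S D : Finset α) (a b : ℕ) (hab : a + b = #S) :
    jumpSum q pos w S D a = jumpSum q pos w S D b := by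
  obtain ⟨w, rfl⟩ := Nat.exists_eq_succ_of_ne_zero hw.ne'
  push_cast
  exact jumpSum_symm_of_sum_symm q hpos (by omega) (sum_pow_attacks_symm q hpos w) S D a b hab

end TwoLetters
-- Generating series of fillings.
section FillingSeries

set_option linter.unusedSectionVars false

variable {β γ R : Type*} [DecidableEq β] [DecidableEq γ] [CommRing R]

/-- The exponent of the monomial of a filling of `T`. -/
def weight {T : Finset β} (σ : T → ℕ+) : ℕ+ →₀ ℕ := ∑ c, Finsupp.single (σ c) 1

/-- The fillings of `T` with monomial `x^d`. -/
def fills (T : Finset β) (d : ℕ+ →₀ ℕ) : Finset (T → ℕ+) :=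
  (Fintype.piFinset fun _ : T => d.support).filter fun σ => weight σ = d

theorem mem_fills {T : Finset β} {d : ℕ+ →₀ ℕ} {σ : T → ℕ+} : σ ∈ fills T d ↔ weight σ = d := by
  simp only [fills, mem_filter, Fintype.mem_piFinset, and_iff_right_iff_imp]
  rintro rfl c
  rw [Finsupp.mem_support_iff, weight, Finsupp.finsetSum_apply]
  exact (lt_of_lt_of_le (by simp) (single_le_sum
    (f := fun c' => (Finsupp.single (σ c') 1 : ℕ+ →₀ ℕ) (σ c)) (fun _ _ => Nat.zero_le _)
    (mem_univ c))).ne'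

/-- Extension of a filling by `1`. -/
def extendOne {T : Finset β} (σ : T → ℕ+) (c : β) : ℕ+ := if h : c ∈ T then σ ⟨c, h⟩ else 1

theorem extendOne_coe {T : Finset β} (σ : T → ℕ+) (c : T) : extendOne σ c = σ c := by
  simp [extendOne]

theorem extendOne_of_mem {T : Finset β} (σ : T → ℕ+) {c : β} (h : c ∈ T) :
    extendOne σ c = σ ⟨c, h⟩ := by
  simp [extendOne, h]

theorem weight_eq_sum {T : Finset β} (σ : T → ℕ+) :
    weight σ = ∑ c ∈ T, Finsupp.single (extendOne σ c) 1 := by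
  rw [← sum_coe_sort, weight]
  simp only [extendOne_coe]

theorem weight_restrict {T : Finset β} (s : β → ℕ+) :
    weight (fun c : T => s c) = ∑ c ∈ T, Finsupp.single (s c) 1 := by
  rw [weight, sum_coe_sort T fun c => Finsupp.single (s c) 1]

/-- The function `f` of functions on `β` only depends on their values on `T`. -/
def DependsOnlyOn {A : Type*} (T : Finset β) (f : (β → ℕ+) → A) : Prop :=
  ∀ s s' : β → ℕ+, (∀ c ∈ T, s c = s' c) → f s = f s'

/-- The generating series of the fillings of `T` with weight `f`. -/
def fillingSeries (T : Finset β) (f : (β → ℕ+) → R) : MvPowerSeries ℕ+ R :=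
  fun d => ∑ σ ∈ fills T d, f (extendOne σ)

theorem coeff_fillingSeries (T : Finset β) (f : (β → ℕ+) → R) (d : ℕ+ →₀ ℕ) :
    MvPowerSeries.coeff d (fillingSeries T f) = ∑ σ ∈ fills T d, f (extendOne σ) := rfl

theorem fillingSeries_empty (f : (β → ℕ+) → R) (hf : f (fun _ => 1) = 1) :
    fillingSeries ∅ f = 1 := by
  classical
  ext d
  rw [coeff_fillingSeries, MvPowerSeries.coeff_one]
  have h1 : ∀ σ : (∅ : Finset β) → ℕ+, weight σ = 0 := fun σ => by simp [weight]
  have h2 : ∀ σ : (∅ : Finset β) → ℕ+, extendOne σ = fun _ => 1 := fun σ => by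
    ext c; simp [extendOne]
  split_ifs with h
  · have : fills (∅ : Finset β) d = univ := by
      ext σ
      rw [mem_fills, h1, h]
      exact ⟨fun _ => mem_univ σ, fun _ => rfl⟩
    rw [this]
    simp [h2, hf]
  · have : fills (∅ : Finset β) d = ∅ := by
      ext σ
      simp [mem_fills, h1, Ne.symm h]
    rw [this, sum_empty]

/-- A filling of T ∪ U is a pair of fillings, and exponents add. Locality of f and g makes the
default entry 1 outside each set irrelevant. -/
theorem fillingSeries_mul {T U : Finset β} (hTU : Disjoint T U) {f g : (β → ℕ+) → R}
    (hf : DependsOnlyOn T f) (hg : DependsOnlyOn U g) :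
    fillingSeries T f * fillingSeries U g = fillingSeries (T ∪ U) fun s => f s * g s := by
  classical
  ext d
  rw [MvPowerSeries.coeff_mul]
  simp only [coeff_fillingSeries, sum_mul_sum, ← sum_product']
  rw [sum_sigma']
  refine sum_nbij'
    (fun x => fun c : (T ∪ U : Finset β) => if (c : β) ∈ T then extendOne x.2.1 c
      else extendOne x.2.2 c)
    (fun σ => ⟨(weight fun c : T => extendOne σ c, weight fun c : U => extendOne σ c),
      (fun c : T => extendOne σ c, fun c : U => extendOne σ c)⟩) ?_ ?_ ?_ ?_ ?_
  · rintro ⟨⟨a, b⟩, σ, τ⟩ h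
    simp only [mem_sigma, HasAntidiagonal.mem_antidiagonal, mem_product, mem_fills] at h ⊢
    obtain ⟨rfl, rfl, rfl⟩ := h
    rw [weight_restrict (T := T ∪ U) fun c => if c ∈ T then extendOne σ c else extendOne τ c,
      sum_union hTU, weight_eq_sum σ, weight_eq_sum τ]
    congr 1
    · exact sum_congr rfl fun c hc => by rw [if_pos hc]
    · exact sum_congr rfl fun c hc => by rw [if_neg (disjoint_right.1 hTU hc)]
  · intro σ h
    simp only [mem_sigma, HasAntidiagonal.mem_antidiagonal, mem_product, mem_fills] at h ⊢
    refine ⟨?_, trivial, trivial⟩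
    rw [weight_restrict, weight_restrict, ← sum_union hTU, ← weight_eq_sum, h]
  · rintro ⟨⟨a, b⟩, σ, τ⟩ h
    simp only [mem_sigma, HasAntidiagonal.mem_antidiagonal, mem_product, mem_fills] at h
    obtain ⟨h1, rfl, rfl⟩ := h
    have e1 : (fun c : T => extendOne (fun c : (T ∪ U : Finset β) => if (c : β) ∈ T
        then extendOne σ c else extendOne τ c) c) = σ := by
      funext c
      rw [extendOne_of_mem _ (mem_union_left _ c.2), if_pos c.2, extendOne_coe]
    have e2 : (fun c : U => extendOne (fun c : (T ∪ U : Finset β) => if (c : β) ∈ T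
        then extendOne σ c else extendOne τ c) c) = τ := by
      funext c
      rw [extendOne_of_mem _ (mem_union_right _ c.2), if_neg (disjoint_right.1 hTU c.2),
        extendOne_coe]
    simp only [e1, e2]
  · intro σ h
    funext c
    by_cases hc : (c : β) ∈ T
    · simp only [hc, if_true]
      rw [extendOne_of_mem _ hc, extendOne_coe]
    · simp only [hc, if_false]
      rw [extendOne_of_mem _ ((mem_union.1 c.2).resolve_left hc), extendOne_coe]
  · rintro ⟨⟨a, b⟩, σ, τ⟩ h
    congr 1
    · refine hf _ _ fun c hc => ?_
      rw [extendOne_of_mem (T := T ∪ U) _ (mem_union_left _ hc), if_pos hc]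
    · refine hg _ _ fun c hc => ?_
      rw [extendOne_of_mem (T := T ∪ U) _ (mem_union_right _ hc),
        if_neg (disjoint_right.1 hTU hc)]

theorem prod_fillingSeries {κ : Type*} [DecidableEq κ] (s : Finset κ) (T : κ → Finset β)
    (f : κ → (β → ℕ+) → R) (hT : ∀ i ∈ s, ∀ j ∈ s, i ≠ j → Disjoint (T i) (T j))
    (hf : ∀ i ∈ s, DependsOnlyOn (T i) (f i)) :
    ∏ i ∈ s, fillingSeries (T i) (f i) = fillingSeries (s.biUnion T) fun x => ∏ i ∈ s, f i x := by
  induction s using Finset.induction_on with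
  | empty => simp [fillingSeries_empty]
  | insert i s hi ih =>
    rw [prod_insert hi, ih (fun a ha b hb => hT a (mem_insert_of_mem ha) b (mem_insert_of_mem hb))
      (fun a ha => hf a (mem_insert_of_mem ha)), biUnion_insert, fillingSeries_mul]
    · simp only [prod_insert hi]
    · rw [disjoint_biUnion_right]
      exact fun j hj => hT i (mem_insert_self _ _) j (mem_insert_of_mem hj)
        fun h => hi (h ▸ hj)
    · exact hf i (mem_insert_self _ _)
    · intro x y h
      refine prod_congr rfl fun j hj => hf j (mem_insert_of_mem hj) _ _ fun c hc => h c ?_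
      exact mem_biUnion.2 ⟨j, hj, hc⟩

theorem fillingSeries_image {T : Finset β} {φ : β → γ} (hφ : Set.InjOn φ T)
    {f : (β → ℕ+) → R} (hf : DependsOnlyOn T f) :
    fillingSeries (T.image φ) (fun s => f (s ∘ φ)) = fillingSeries T f := by
  ext d
  simp only [coeff_fillingSeries]
  let e : T ≃ (T.image φ : Finset γ) :=
    Equiv.ofBijective (fun c => ⟨φ c, mem_image_of_mem φ c.2⟩) ⟨fun a b h =>
      Subtype.ext (hφ a.2 b.2 (congrArg Subtype.val h)), fun c => by
        obtain ⟨b, hb, h⟩ := mem_image.1 c.2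
        exact ⟨⟨b, hb⟩, Subtype.ext h⟩⟩
  refine sum_nbij' (fun σ => σ ∘ e) (fun σ => σ ∘ e.symm) ?_ ?_ ?_ ?_ ?_
  · intro σ h
    rw [mem_fills] at h ⊢
    rw [← h, weight, weight]
    exact e.sum_comp fun c => Finsupp.single (σ c) 1
  · intro σ h
    rw [mem_fills] at h ⊢
    rw [← h, weight, weight]
    exact e.symm.sum_comp fun c => Finsupp.single (σ c) 1
  · intro σ _
    funext c
    simp
  · intro σ _
    funext c
    simp
  · intro σ _
    refine hf _ _ fun c hc => ?_
    rw [Function.comp_apply, extendOne_of_mem _ (mem_image_of_mem φ hc), extendOne_of_mem _ hc]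
    rfl

end FillingSeries

/-! ### Inversions and major index on sets of boxes. -/

section Statistics

/-- The entry directly below a box, `0` below the first row. -/
def below (s : ℕ × ℕ → ℕ+) : ℕ × ℕ → ℕ
  | (0, _) => 0
  | (i + 1, j) => s (i, j)

/-- The condition on entries for an inversion pair. -/
def Triple (s : ℕ × ℕ → ℕ+) (c c' : ℕ × ℕ) : Prop :=
  ((s c : ℕ) ≤ below s c ∧ below s c < s c') ∨
    (below s c < s c' ∧ (s c' : ℕ) < s c) ∨ ((s c' : ℕ) < s c ∧ (s c : ℕ) ≤ below s c)

instance (s : ℕ × ℕ → ℕ+) (c c' : ℕ × ℕ) : Decidable (Triple s c c') :=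
  inferInstanceAs (Decidable (_ ∨ _))

/-- The number of inversion pairs inside a set `T` of boxes. -/
def invOn (T : Finset (ℕ × ℕ)) (s : ℕ × ℕ → ℕ+) : ℕ :=
  #{p ∈ T ×ˢ T | p.1.1 = p.2.1 ∧ p.1.2 < p.2.2 ∧ Triple s p.1 p.2}

/-- The major index of the boxes in `T`, for columns of heights `h j`. -/
def majOn (h : ℕ → ℕ) (T : Finset (ℕ × ℕ)) (s : ℕ × ℕ → ℕ+) : ℕ :=
  ∑ c ∈ T with c.1 ≠ 0 ∧ below s c < s c, (h c.2 - (c.1 + 1) + 1)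

theorem entry_eq_extendOne {nu : YoungDiagram} (σ : Filling nu) {c : ℕ × ℕ} (hc : c ∈ nu.cells) :
    σ.entry c = extendOne σ c := by
  rw [extendOne_of_mem _ hc, Filling.entry, dif_pos hc]

theorem entryBelow_eq_below {nu : YoungDiagram} (σ : Filling nu) {c : ℕ × ℕ}
    (hc : c ∈ nu.cells) : σ.entryBelow c = below (extendOne σ) c := by
  obtain ⟨i | i, j⟩ := c
  · rfl
  · refine entry_eq_extendOne σ ?_
    exact nu.isLowerSet (Prod.mk_le_mk.2 ⟨Nat.le_succ i, le_rfl⟩ : (i, j) ≤ (i + 1, j)) hc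

theorem inv_eq_invOn {nu : YoungDiagram} (σ : Filling nu) :
    σ.inv = invOn nu.cells (extendOne σ) := by
  rw [Filling.inv, Filling.invPairs, invOn]
  congr 1
  refine filter_congr fun p hp => ?_
  obtain ⟨h1, h2⟩ := mem_product.1 hp
  rw [entry_eq_extendOne σ h1, entry_eq_extendOne σ h2, entryBelow_eq_below σ h1]
  rfl

theorem maj_eq_majOn {nu : YoungDiagram} (σ : Filling nu) :
    σ.maj = majOn nu.colLen nu.cells (extendOne σ) := by
  rw [Filling.maj, Filling.des, majOn]
  refine sum_congr (filter_congr fun c hc => ?_) fun _ _ => rfl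
  rw [entry_eq_extendOne σ hc, entryBelow_eq_below σ hc]

theorem macdonald_eq_fillingSeries {R : Type*} [CommRing R] (q t : R) (nu : YoungDiagram) :
    macdonald q t nu =
      fillingSeries nu.cells fun s => q ^ invOn nu.cells s * t ^ majOn nu.colLen nu.cells s := by
  ext d
  change ∑ σ ∈ fillings nu d, q ^ σ.inv * t ^ σ.maj = _
  simp only [inv_eq_invOn, maj_eq_majOn]
  rfl

/-- Closure of a set of boxes under going down. -/
def DownClosed (T : Finset (ℕ × ℕ)) : Prop := ∀ i j, (i + 1, j) ∈ T → (i, j) ∈ T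

theorem below_congr {T : Finset (ℕ × ℕ)} (hT : DownClosed T) {s s' : ℕ × ℕ → ℕ+}
    (h : ∀ c ∈ T, s c = s' c) {c : ℕ × ℕ} (hc : c ∈ T) : below s c = below s' c := by
  obtain ⟨i | i, j⟩ := c
  · rfl
  · exact congrArg PNat.val (h _ (hT i j hc))

theorem dependsOnlyOn_invOn {T : Finset (ℕ × ℕ)} (hT : DownClosed T) :
    DependsOnlyOn T (invOn T) := by
  intro s s' h
  rw [invOn, invOn]
  congr 1
  refine filter_congr fun p hp => ?_
  obtain ⟨h1, h2⟩ := mem_product.1 hp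
  rw [Triple, Triple, h _ h1, h _ h2, below_congr hT h h1]

theorem dependsOnlyOn_majOn {T : Finset (ℕ × ℕ)} (hT : DownClosed T) (hh : ℕ → ℕ) :
    DependsOnlyOn T (majOn hh T) := by
  intro s s' h
  rw [majOn, majOn]
  refine sum_congr (filter_congr fun c hc => ?_) fun _ _ => rfl
  rw [h _ hc, below_congr hT h hc]

theorem majOn_biUnion {κ : Type*} [DecidableEq κ] (h : ℕ → ℕ) (s : ℕ × ℕ → ℕ+) (P : Finset κ)
    (T : κ → Finset (ℕ × ℕ)) (hT : ∀ i ∈ P, ∀ j ∈ P, i ≠ j → Disjoint (T i) (T j)) :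
    majOn h (P.biUnion T) s = ∑ i ∈ P, majOn h (T i) s := by
  simp only [majOn, sum_filter]
  exact sum_biUnion hT

end Statistics

/-! ### Reduction of the cumulant to one multigraph per filling. -/

section Columns

variable {r : ℕ}

/-- The boxes of `mu` in the columns in `B`. -/
def columnCells (mu : YoungDiagram) (B : Finset (Fin r)) : Finset (ℕ × ℕ) :=
  {c ∈ mu.cells | ∃ b ∈ B, (b : ℕ) = c.2}

theorem mem_columnCells {mu : YoungDiagram} {B : Finset (Fin r)} {i j : ℕ} :
    (i, j) ∈ columnCells mu B ↔ i < mu.colLen j ∧ ∃ b ∈ B, (b : ℕ) = j := by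
  rw [columnCells, mem_filter, YoungDiagram.mem_cells, YoungDiagram.mem_iff_lt_colLen]

theorem downClosed_columnCells (mu : YoungDiagram) (B : Finset (Fin r)) :
    DownClosed (columnCells mu B) := by
  intro i j h
  rw [mem_columnCells] at h ⊢
  exact ⟨(Nat.lt_succ_self i).trans h.1, h.2⟩

theorem disjoint_columnCells (mu : YoungDiagram) {B C : Finset (Fin r)} (h : Disjoint B C) :
    Disjoint (columnCells mu B) (columnCells mu C) := by
  rw [disjoint_left]
  rintro ⟨i, j⟩ h1 h2
  obtain ⟨-, b, hb, rfl⟩ := mem_columnCells.1 h1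
  obtain ⟨-, c, hc, hbc⟩ := mem_columnCells.1 h2
  exact disjoint_left.1 h hb (Fin.ext hbc ▸ hc)

/-- The index of the column `j` among the columns in `B`. -/
def columnIndex (B : Finset (Fin r)) (j : ℕ) : ℕ := #{b ∈ B | ((b : Fin r) : ℕ) < j}

theorem columnIndex_lt {B : Finset (Fin r)} {b : Fin r} (hb : b ∈ B) {k : ℕ} (hk : (b : ℕ) < k) :
    columnIndex B b < columnIndex B k := by
  refine card_lt_card ((ssubset_iff_of_subset ?_).2 ⟨b, ?_, ?_⟩)
  · exact monotone_filter_right B fun x _ hx => lt_trans hx hk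
  · exact mem_filter.2 ⟨hb, hk⟩
  · simp

theorem columnIndex_lt_iff {B : Finset (Fin r)} {b c : Fin r} (hb : b ∈ B) (hc : c ∈ B) :
    columnIndex B b < columnIndex B c ↔ (b : ℕ) < c := by
  refine ⟨fun h => ?_, columnIndex_lt hb⟩
  by_contra hle
  rcases (not_lt.1 hle).lt_or_eq with h' | h'
  · exact (columnIndex_lt hc h').not_gt h
  · rw [h'] at h
    exact lt_irrefl _ h

theorem exists_columnIndex_eq {B : Finset (Fin r)} {k : ℕ} (hk : k < #B) :
    ∃ b ∈ B, columnIndex B b = k := by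
  have := surj_on_of_inj_on_of_card_le (s := B) (t := range #B) (fun b _ => columnIndex B b)
    (fun b hb => mem_range.2 (card_lt_card ((ssubset_iff_of_subset (filter_subset _ _)).2
      ⟨b, hb, by simp⟩)))
    (fun b c hb hc h => by
      rcases lt_trichotomy b c with h' | h' | h'
      · exact absurd h ((columnIndex_lt_iff hb hc).2 h').ne
      · exact h'
      · exact absurd h ((columnIndex_lt_iff hc hb).2 h').ne')
    (by simp) k (mem_range.2 hk)
  obtain ⟨b, hb, h⟩ := this
  exact ⟨b, hb, h.symm⟩

theorem rowLen_column (k i : ℕ) : (column k).rowLen i = if i < k then 1 else 0 := by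
  have h : ∀ j, j < (column k).rowLen i ↔ i < k ∧ j = 0 := by
    intro j
    rw [← YoungDiagram.mem_iff_lt_rowLen, ← YoungDiagram.mem_cells, column]
    simp [eq_comm]
  have h0 := h 0
  have h1 := h 1
  split_ifs with hi <;>
    simp only [hi, true_and, false_and, one_ne_zero, iff_false, iff_true] at h0 h1 <;> omega

theorem mem_oplus_column {mu : YoungDiagram} {B : Finset (Fin r)} {i k : ℕ} :
    (i, k) ∈ oplus B (fun j : Fin r => column (mu.colLen j)) ↔
      k < #{b ∈ B | i < mu.colLen (b : Fin r)} := by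
  rw [mem_oplus, card_filter]
  simp only [rowLen_column]

/-- Column heights decrease, so the columns of B that reach row i form an initial segment of B, and
b is in it exactly when its index is less than their number. -/
theorem mem_oplus_columnIndex {mu : YoungDiagram} {B : Finset (Fin r)} {i : ℕ} {b : Fin r}
    (hb : b ∈ B) :
    (i, columnIndex B b) ∈ oplus B (fun j : Fin r => column (mu.colLen j)) ↔
      i < mu.colLen b := by
  rw [mem_oplus_column]
  constructor
  · intro h
    by_contra hi
    refine h.not_ge (card_le_card fun x hx => ?_)
    obtain ⟨hxB, hx⟩ := mem_filter.1 hx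
    refine mem_filter.2 ⟨hxB, ?_⟩
    by_contra hle
    exact hi (hx.trans_le (mu.colLen_anti _ _ (not_lt.1 hle)))
  · intro hi
    refine card_lt_card ((ssubset_iff_of_subset fun x hx => ?_).2 ⟨b, ?_, by simp⟩)
    · obtain ⟨hxB, hx⟩ := mem_filter.1 hx
      exact mem_filter.2 ⟨hxB, hi.trans_le (mu.colLen_anti _ _ hx.le)⟩
    · exact mem_filter.2 ⟨hb, hi⟩

theorem colLen_oplus_columnIndex {mu : YoungDiagram} {B : Finset (Fin r)} {b : Fin r}
    (hb : b ∈ B) :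
    (oplus B (fun j : Fin r => column (mu.colLen j))).colLen (columnIndex B b) =
      mu.colLen b := by
  refine eq_of_forall_lt_iff fun i => ?_
  rw [← YoungDiagram.mem_iff_lt_colLen, mem_oplus_columnIndex hb]

theorem image_columnCells (mu : YoungDiagram) (B : Finset (Fin r)) :
    (columnCells mu B).image (fun c => (c.1, columnIndex B c.2)) =
      (oplus B (fun j : Fin r => column (mu.colLen j))).cells := by
  ext ⟨i, k⟩
  rw [mem_image, YoungDiagram.mem_cells]
  constructor
  · rintro ⟨⟨i', j⟩, h, heq⟩
    obtain ⟨h1, b, hb, rfl⟩ := mem_columnCells.1 h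
    rw [← heq]
    exact (mem_oplus_columnIndex hb).2 h1
  · intro h
    have hk := mem_oplus_column.1 h
    obtain ⟨b, hb, rfl⟩ := exists_columnIndex_eq (hk.trans_le (card_filter_le _ _))
    exact ⟨(i, b), mem_columnCells.2 ⟨(mem_oplus_columnIndex hb).1 h, b, hb, rfl⟩, rfl⟩

theorem injOn_columnCells (mu : YoungDiagram) (B : Finset (Fin r)) :
    Set.InjOn (fun c : ℕ × ℕ => (c.1, columnIndex B c.2)) (columnCells mu B) := by
  rintro ⟨i, j⟩ h ⟨i', j'⟩ h' heq
  obtain ⟨-, b, hb, rfl⟩ := mem_columnCells.1 h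
  obtain ⟨-, c, hc, rfl⟩ := mem_columnCells.1 h'
  obtain ⟨rfl, hbc⟩ := Prod.mk.inj heq
  rcases lt_trichotomy (b : ℕ) c with h' | h' | h'
  · exact absurd hbc ((columnIndex_lt_iff hb hc).2 h').ne
  · exact Prod.ext rfl h'
  · exact absurd hbc ((columnIndex_lt_iff hc hb).2 h').ne'

theorem below_comp (s : ℕ × ℕ → ℕ+) (ψ : ℕ → ℕ) (c : ℕ × ℕ) :
    below s (c.1, ψ c.2) = below (s ∘ fun c => (c.1, ψ c.2)) c := by
  obtain ⟨i | i, j⟩ := c <;> rfl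

/-- Closing the gaps between the columns in B keeps their order and heights, hence both statistics.
All the polynomials in the cumulant are thereby placed on the boxes of the one diagram `mu`. -/
theorem macdonald_oplus_column {R : Type*} [CommRing R] (q t : R) (mu : YoungDiagram)
    (B : Finset (Fin r)) :
    macdonald q t (oplus B fun j : Fin r => column (mu.colLen j)) =
      fillingSeries (columnCells mu B) fun s =>
        q ^ invOn (columnCells mu B) s * t ^ majOn mu.colLen (columnCells mu B) s := by
  have hdep : DependsOnlyOn (columnCells mu B) fun s =>
      q ^ invOn (columnCells mu B) s * t ^ majOn mu.colLen (columnCells mu B) s := by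
    intro s s' h
    simp only
    rw [dependsOnlyOn_invOn (downClosed_columnCells mu B) s s' h,
      dependsOnlyOn_majOn (downClosed_columnCells mu B) _ s s' h]
  have hinj := injOn_columnCells mu B
  rw [macdonald_eq_fillingSeries, ← fillingSeries_image hinj hdep, image_columnCells]
  congr 1
  funext s
  congr 2
  · rw [← image_columnCells, invOn, invOn]
    simp only [card_filter, sum_product]
    rw [sum_image hinj]
    refine sum_congr rfl fun c hc => ?_
    rw [sum_image hinj]
    refine sum_congr rfl fun c' hc' => if_congr ?_ rfl rfl
    obtain ⟨i, j⟩ := c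
    obtain ⟨i', j'⟩ := c'
    obtain ⟨-, b, hb, rfl⟩ := mem_columnCells.1 hc
    obtain ⟨-, b', hb', rfl⟩ := mem_columnCells.1 hc'
    have hbel := below_comp s (columnIndex B) (i, b)
    simp only [columnIndex_lt_iff hb hb', Triple] at hbel ⊢
    rw [hbel]
    rfl
  · rw [majOn, majOn, sum_filter, sum_filter, ← image_columnCells, sum_image hinj]
    refine sum_congr rfl fun c hc => ?_
    obtain ⟨i, j⟩ := c
    obtain ⟨-, b, hb, rfl⟩ := mem_columnCells.1 hc
    have hbel := below_comp s (columnIndex B) (i, b)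
    simp only [colLen_oplus_columnIndex hb] at hbel ⊢
    rw [hbel]
    rfl

/-- The number of inversion pairs between the columns `j` and `k` of `mu`. -/
def columnInv (mu : YoungDiagram) (s : ℕ × ℕ → ℕ+) (j k : Fin r) : ℕ :=
  #{p ∈ mu.cells ×ˢ mu.cells | p.1.2 = (j : ℕ) ∧ p.2.2 = (k : ℕ) ∧ p.1.1 = p.2.1 ∧
    p.1.2 < p.2.2 ∧ Triple s p.1 p.2}

theorem invOn_columnCells (mu : YoungDiagram) (s : ℕ × ℕ → ℕ+) (B : Finset (Fin r)) :
    invOn (columnCells mu B) s = edgeCount (columnInv mu s) B := by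
  rw [invOn, edgeCount]
  simp only [columnInv]
  rw [← card_biUnion]
  · congr 1
    ext ⟨c, c'⟩
    simp only [mem_filter, mem_product, mem_biUnion, columnCells, Prod.exists]
    constructor
    · rintro ⟨⟨⟨hc, b, hb, hbc⟩, hc', b', hb', hbc'⟩, h1, h2, h3⟩
      exact ⟨b, b', ⟨⟨hb, hb'⟩, by rw [Fin.lt_def]; omega⟩, ⟨hc, hc'⟩, hbc.symm, hbc'.symm, h1, h2,
        h3⟩
    · rintro ⟨b, b', ⟨⟨hb, hb'⟩, hlt⟩, ⟨hc, hc'⟩, hbc, hbc', h1, h2, h3⟩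
      rw [Fin.lt_def] at hlt
      exact ⟨⟨⟨hc, b, hb, hbc.symm⟩, hc', b', hb', hbc'.symm⟩, h1, h2, h3⟩
  · rintro ⟨a, b⟩ - ⟨a', b'⟩ - hne
    rw [Function.onFun, disjoint_filter]
    rintro p - ⟨h1, h2, -⟩ ⟨h3, h4, -⟩
    exact hne (Prod.ext (Fin.ext (h1.symm.trans h3)) (Fin.ext (h2.symm.trans h4)))

/-- The blocks of a set partition cut `mu` into disjoint sets of columns. The total major index does
not depend on the partition, so its power of t comes out of the sum. -/
theorem coeff_cumulant_columns {R : Type*} [CommRing R] (q t : R) (mu : YoungDiagram)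
    (d : ℕ+ →₀ ℕ) :
    MvPowerSeries.coeff d (jointCumulant fun B : Finset (Fin (mu.rowLen 0)) =>
        macdonald q t (oplus B fun j => column (mu.colLen j))) =
      ∑ σ ∈ fills mu.cells d, t ^ majOn mu.colLen mu.cells (extendOne σ) *
        cumulant (fun B : Finset (Fin (mu.rowLen 0)) =>
          q ^ edgeCount (columnInv mu (extendOne σ)) B) univ := by
  have hprod : ∀ π : Finpartition (univ : Finset (Fin (mu.rowLen 0))),
      ∏ B ∈ π.parts, macdonald q t (oplus B fun j => column (mu.colLen j)) =
        fillingSeries mu.cells fun s => t ^ majOn mu.colLen mu.cells s *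
          ∏ B ∈ π.parts, q ^ edgeCount (columnInv mu s) B := by
    intro π
    simp only [macdonald_oplus_column]
    have hdis : ∀ B ∈ π.parts, ∀ C ∈ π.parts, B ≠ C →
        Disjoint (columnCells mu B) (columnCells mu C) :=
      fun B hB C hC hne => disjoint_columnCells mu (π.disjoint hB hC hne)
    rw [prod_fillingSeries _ _ _ hdis]
    · have hcells : π.parts.biUnion (columnCells mu) = mu.cells := by
        ext ⟨i, j⟩
        simp only [mem_biUnion, columnCells, mem_filter]
        constructor
        · rintro ⟨B, -, h, -⟩
          exact h
        · intro h
          have hj : j < mu.rowLen 0 := YoungDiagram.mem_iff_lt_rowLen.1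
            (mu.isLowerSet (Prod.mk_le_mk.2 ⟨Nat.zero_le i, le_rfl⟩ : (0, j) ≤ (i, j)) h)
          obtain ⟨B, hB, hjB⟩ := π.exists_mem (mem_univ ⟨j, hj⟩)
          exact ⟨B, hB, h, _, hjB, rfl⟩
      rw [hcells]
      congr 1
      funext s
      rw [prod_mul_distrib, prod_pow_eq_pow_sum, prod_pow_eq_pow_sum, prod_pow_eq_pow_sum,
        ← majOn_biUnion _ _ _ _ hdis, hcells, mul_comm]
      simp only [invOn_columnCells]
    · intro B _ s s' h
      simp only
      rw [dependsOnlyOn_invOn (downClosed_columnCells mu B) s s' h,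
        dependsOnlyOn_majOn (downClosed_columnCells mu B) _ s s' h]
  rw [jointCumulant, map_sum]
  simp only [cumulant, mul_sum]
  rw [sum_comm]
  refine sum_congr rfl fun π _ => ?_
  have hC : ((-1 : MvPowerSeries ℕ+ R) ^ (#π.parts - 1) * ((#π.parts - 1).factorial :
      MvPowerSeries ℕ+ R)) = MvPowerSeries.C (cumulantCoeff R #π.parts) := by
    simp [cumulantCoeff]
  rw [hC, MvPowerSeries.coeff_C_mul, hprod, coeff_fillingSeries, mul_sum]
  exact sum_congr rfl fun σ _ => by ring

end Columns
-- Inversions as attacking inversions minus arms of descents.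
section AttackFormula

/-- Reading order position, for diagrams of width less than `w`. -/
def readPos (w : ℕ) (c : ℕ × ℕ) : ℤ := (c.2 : ℤ) - w * c.1

theorem snd_lt_width {nu : YoungDiagram} {c : ℕ × ℕ} (h : c ∈ nu.cells) :
    c.2 < nu.rowLen 0 + 1 :=
  Nat.lt_succ_of_lt (YoungDiagram.mem_iff_lt_rowLen.1
    (nu.isLowerSet (Prod.mk_le_mk.2 ⟨Nat.zero_le c.1, le_rfl⟩ : (0, c.2) ≤ (c.1, c.2)) h))

theorem readPos_sub_mem {w : ℕ} {c c' : ℕ × ℕ} (hc : c.2 < w) (hc' : c'.2 < w) :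
    (0 < readPos w c' - readPos w c ∧ readPos w c' - readPos w c < w) ↔
      (c.1 = c'.1 ∧ c.2 < c'.2) ∨ (c.1 = c'.1 + 1 ∧ c'.2 < c.2) := by
  obtain ⟨i, j⟩ := c
  obtain ⟨i', j'⟩ := c'
  simp only [readPos] at *
  have hd : (j' : ℤ) - w * i' - (j - w * i) = j' - j + w * (i - i') := by ring
  rw [hd]
  have hw : (0 : ℤ) < w := by omega
  rcases lt_trichotomy i i' with h | rfl | h
  · have : (w : ℤ) * (i - i') ≤ w * (-1) := by
      apply mul_le_mul_of_nonneg_left _ hw.le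
      omega
    constructor <;> intro h' <;> omega
  · rw [sub_self, mul_zero]
    omega
  · obtain ⟨k, rfl⟩ := Nat.exists_eq_add_of_lt h
    rcases k with _ | k
    · push_cast
      have : (w : ℤ) * (i' + 0 + 1 - i') = w := by ring
      rw [this]
      omega
    · have : (w : ℤ) * 2 ≤ w * (((i' + (k + 1) + 1 : ℕ) : ℤ) - i') := by
        apply mul_le_mul_of_nonneg_left _ hw.le
        push_cast
        omega
      constructor <;> intro h' <;> omega

theorem readPos_eq_iff {w : ℕ} {c c' : ℕ × ℕ} (hc : c.2 < w) (hc' : c'.2 < w) :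
    readPos w c' = readPos w c + w ↔ c.1 = c'.1 + 1 ∧ c'.2 = c.2 := by
  obtain ⟨i, j⟩ := c
  obtain ⟨i', j'⟩ := c'
  simp only [readPos] at *
  have hw : (0 : ℤ) < w := by omega
  constructor
  · intro h
    have hd : (w : ℤ) * (i' + 1 - i) = j' - j := by linarith
    have hj : (j' : ℤ) - j = 0 :=
      Int.eq_zero_of_abs_lt_dvd ⟨_, hd.symm⟩ (abs_lt.2 (by omega))
    rw [hj] at hd
    have hz := (mul_eq_zero.1 hd).resolve_left hw.ne'
    omega
  · rintro ⟨rfl, rfl⟩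
    push_cast
    ring

theorem readPos_injective (nu : YoungDiagram) :
    Function.Injective fun c : nu.cells => readPos (nu.rowLen 0 + 1) c := by
  rintro ⟨⟨i, j⟩, hc⟩ ⟨⟨i', j'⟩, hc'⟩ h
  have h1 := snd_lt_width hc
  have h2 := snd_lt_width hc'
  -- Raising one box by a row turns equality of positions into distance exactly w.
  have h3 := (readPos_eq_iff (w := nu.rowLen 0 + 1) (c := (i + 1, j)) (c' := (i', j')) h1 h2).1 (by
    simp only [readPos] at h ⊢
    push_cast at h ⊢
    linarith)
  simp only at h3
  exact Subtype.ext (Prod.ext (by simp only; omega) h3.2.symm)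

/-- The number of boxes to the right of `c` in its row. -/
def armLen (nu : YoungDiagram) (c : ℕ × ℕ) : ℕ := #{c' ∈ nu.cells | c.1 = c'.1 ∧ c.2 < c'.2}

/-- The inversions of `σ` among attacking pairs. -/
def attackInv {α : Type*} [Fintype α] (pos : α → ℤ) (w : ℤ) (σ : α → ℕ+) : ℕ :=
  #{p : α × α | (0 < pos p.2 - pos p.1 ∧ pos p.2 - pos p.1 < w) ∧ σ p.2 < σ p.1}

/-- The descents of `σ`, in terms of positions. -/
def descents {α : Type*} [Fintype α] (pos : α → ℤ) (w : ℤ) (σ : α → ℕ+) : Finset α :=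
  open Classical in {u | ∃ v, pos v = pos u + w ∧ σ v < σ u}

/-- The pair (u, v) goes to the pair formed by v and the box below u. -/
theorem below_lt_card_eq (nu : YoungDiagram) (s : ℕ × ℕ → ℕ+) :
    #{p ∈ nu.cells ×ˢ nu.cells |
        (p.1.1 = p.2.1 ∧ p.1.2 < p.2.2) ∧ p.1.1 ≠ 0 ∧ below s p.1 < s p.2} =
      #{p ∈ nu.cells ×ˢ nu.cells | (p.1.1 = p.2.1 + 1 ∧ p.2.2 < p.1.2) ∧ s p.2 < s p.1} := by
  refine card_nbij' (fun p => (p.2, (p.1.1 - 1, p.1.2))) (fun p => ((p.2.1 + 1, p.2.2), p.1))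
    ?_ ?_ ?_ ?_
  · rintro ⟨⟨i, j⟩, i', j'⟩ h
    simp only [coe_filter, mem_product, Set.mem_ofPred_eq] at h ⊢
    obtain ⟨⟨h1, h2⟩, ⟨rfl, h3⟩, h4, h5⟩ := h
    obtain ⟨i, rfl⟩ := Nat.exists_eq_succ_of_ne_zero h4
    exact ⟨⟨h2, nu.isLowerSet (Prod.mk_le_mk.2 ⟨Nat.le_succ i, le_rfl⟩ : (i, j) ≤ (i + 1, j)) h1⟩,
      ⟨rfl, h3⟩, h5⟩
  · rintro ⟨⟨i, j⟩, i', j'⟩ h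
    simp only [coe_filter, mem_product, Set.mem_ofPred_eq] at h ⊢
    obtain ⟨⟨h1, h2⟩, ⟨rfl, h3⟩, h5⟩ := h
    exact ⟨⟨nu.isLowerSet (Prod.mk_le_mk.2 ⟨le_rfl, h3.le⟩ : (i' + 1, j') ≤ (i' + 1, j)) h1, h1⟩,
      ⟨rfl, h3⟩, Nat.succ_ne_zero _, h5⟩
  · rintro ⟨⟨i, j⟩, i', j'⟩ h
    simp only [coe_filter, mem_product, Set.mem_ofPred_eq] at h ⊢
    obtain ⟨-, ⟨rfl, h3⟩, h4, h5⟩ := h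
    obtain ⟨i, rfl⟩ := Nat.exists_eq_succ_of_ne_zero h4
    rfl
  · rintro ⟨⟨i, j⟩, i', j'⟩ h
    rfl

/-- A case check on the relative order of three entries. In the first row the entry below is 0, so
both comparisons with it hold and can be dropped from the two sides. -/
theorem triple_add_descent (s : ℕ × ℕ → ℕ+) (c c' : ℕ × ℕ) :
    (if Triple s c c' then 1 else 0) + (if c.1 ≠ 0 ∧ below s c < s c then 1 else 0) =
      (if s c' < s c then 1 else 0) + (if c.1 ≠ 0 ∧ below s c < s c' then 1 else 0) := by
  have key : ∀ a b c : ℕ, (if (a ≤ c ∧ c < b) ∨ (c < b ∧ b < a) ∨ (b < a ∧ a ≤ c) then 1 else 0) +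
      (if c < a then 1 else 0) = (if b < a then 1 else 0) + (if c < b then 1 else 0) := by
    intro a b c
    simp only [← not_lt]
    by_cases h1 : c < a <;> by_cases h2 : c < b <;> by_cases h3 : b < a <;>
      simp only [h1, h2, h3, not_true_eq_false, not_false_eq_true, and_true, and_false,
        or_false, or_true, if_true, if_false] <;> omega
  obtain ⟨i | i, j⟩ := c
  · have h1 : below s (0, j) = 0 := rfl
    have h2 := (s (0, j)).pos
    have h3 := (s c').pos
    have h4 := key (s (0, j)) (s c') 0
    simp only [h2, h3, if_true, Nat.add_right_cancel_iff] at h4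
    simp only [Triple, h1, ne_eq, not_true_eq_false, false_and, if_false, add_zero, h3,
      ← PNat.coe_lt_coe]
    rw [← h4]
  · have h4 := key (s (i + 1, j)) (s c') (below s (i + 1, j))
    simp only [ne_eq, Nat.succ_ne_zero, not_false_eq_true, true_and, ← PNat.coe_lt_coe]
    rw [← h4]
    rfl

/-- Sum `triple_add_descent` over the pairs in a common row: a descent is counted once for each box
to its right, which gives its arm. The two comparisons on the other side run through the two kinds
of attacking pairs. -/
theorem attackInv_eq (nu : YoungDiagram) (σ : nu.cells → ℕ+) :
    invOn nu.cells (extendOne σ) +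
      ∑ c ∈ nu.cells with c.1 ≠ 0 ∧ below (extendOne σ) c < extendOne σ c, armLen nu c =
    attackInv (fun c : nu.cells => readPos (nu.rowLen 0 + 1) c) ((nu.rowLen 0 + 1 : ℕ) : ℤ) σ := by
  set s := extendOne σ with hs
  have h1 : attackInv (fun c : nu.cells => readPos (nu.rowLen 0 + 1) c)
      ((nu.rowLen 0 + 1 : ℕ) : ℤ) σ =
      #{p ∈ nu.cells ×ˢ nu.cells | (p.1.1 = p.2.1 ∧ p.1.2 < p.2.2) ∧ s p.2 < s p.1} +
      #{p ∈ nu.cells ×ˢ nu.cells | (p.1.1 = p.2.1 + 1 ∧ p.2.2 < p.1.2) ∧ s p.2 < s p.1} := by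
    simp only [attackInv, card_filter, sum_product, ← univ_product_univ]
    rw [← sum_add_distrib, ← sum_coe_sort nu.cells]
    refine sum_congr rfl fun u _ => ?_
    rw [← sum_add_distrib, ← sum_coe_sort nu.cells]
    refine sum_congr rfl fun v _ => ?_
    simp only [readPos_sub_mem (snd_lt_width u.2) (snd_lt_width v.2), hs, extendOne_coe]
    by_cases h : σ v < σ u
    · simp only [h, and_true]
      split_ifs <;> omega
    · simp [h]
  rw [h1, ← below_lt_card_eq, invOn]
  simp only [armLen, card_filter, sum_filter, sum_product]
  rw [← sum_add_distrib, ← sum_add_distrib]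
  refine sum_congr rfl fun u _ => ?_
  have h2 : (if u.1 ≠ 0 ∧ below s u < s u then
      ∑ v ∈ nu.cells, (if u.1 = v.1 ∧ u.2 < v.2 then 1 else 0) else 0) =
      ∑ v ∈ nu.cells, if u.1 = v.1 ∧ u.2 < v.2 then
        (if u.1 ≠ 0 ∧ below s u < s u then 1 else 0) else 0 := by
    split_ifs
    · rfl
    · simp
  rw [h2, ← sum_add_distrib, ← sum_add_distrib]
  refine sum_congr rfl fun v _ => ?_
  by_cases h : u.1 = v.1 ∧ u.2 < v.2
  · have := triple_add_descent s u v
    simpa only [h, true_and, and_self, if_true, and_true] using this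
  · have h' : ¬ (u.1 = v.1 ∧ u.2 < v.2 ∧ Triple s u v) := fun h'' => h ⟨h''.1, h''.2.1⟩
    simp only [h, h', false_and, if_false]

theorem sum_descents_eq (nu : YoungDiagram) (σ : nu.cells → ℕ+) (g : ℕ × ℕ → ℕ) :
    ∑ c ∈ nu.cells with c.1 ≠ 0 ∧ below (extendOne σ) c < extendOne σ c, g c =
      ∑ c ∈ descents (fun c : nu.cells => readPos (nu.rowLen 0 + 1) c)
        ((nu.rowLen 0 + 1 : ℕ) : ℤ) σ, g c := by
  rw [sum_filter, ← sum_coe_sort nu.cells, descents, sum_filter]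
  refine sum_congr rfl fun u _ => if_congr ?_ rfl rfl
  rw [extendOne_coe]
  constructor
  · obtain ⟨⟨i | i, j⟩, hu⟩ := u
    · rintro ⟨h, -⟩
      exact absurd rfl h
    · rintro ⟨-, h⟩
      have hv : (i, j) ∈ nu.cells :=
        nu.isLowerSet (Prod.mk_le_mk.2 ⟨Nat.le_succ i, le_rfl⟩ : (i, j) ≤ (i + 1, j)) hu
      refine ⟨⟨(i, j), hv⟩, (readPos_eq_iff (snd_lt_width hu) (snd_lt_width hv)).2 ⟨rfl, rfl⟩, ?_⟩
      have h' : ((extendOne σ (i, j) : ℕ+) : ℕ) < σ ⟨(i + 1, j), hu⟩ := h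
      rwa [extendOne_of_mem _ hv, PNat.coe_lt_coe] at h'
  · rintro ⟨v, h1, h2⟩
    obtain ⟨⟨i, j⟩, hu⟩ := u
    obtain ⟨⟨i', j'⟩, hv⟩ := v
    obtain ⟨h3, h4⟩ := (readPos_eq_iff (snd_lt_width hu) (snd_lt_width hv)).1 h1
    simp only at h3 h4
    subst h3 h4
    refine ⟨Nat.succ_ne_zero _, ?_⟩
    change ((extendOne σ (i', j') : ℕ+) : ℕ) < _
    rwa [extendOne_of_mem _ hv, PNat.coe_lt_coe]

end AttackFormula

/-! ### Splitting one letter into two adjacent letters. -/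

section Paint

variable {α : Type*} [Fintype α] [DecidableEq α]

/-- Replace the entries of `β` in `A` by `b`. -/
def paint (β : α → ℕ+) (b : ℕ+) (A : Finset α) (c : α) : ℕ+ := if c ∈ A then b else β c

/-- Since a + 1 is not used by β, raising some entries a to a + 1 changes only comparisons between a
raised and an unraised a. -/
theorem attackInv_paint (pos : α → ℤ) (w : ℤ) {β : α → ℕ+} {a : ℕ+} (hβ : ∀ c, β c ≠ a + 1)
    {A : Finset α} (hA : A ⊆ univ.filter (β · = a)) :
    attackInv pos w (paint β (a + 1) A) =
      attackInv pos w β + attacks pos w A (univ.filter (β · = a) \ A) := by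
  have hatt : attacks pos w A (univ.filter (β · = a) \ A) = #{p : α × α |
      (p.1 ∈ A ∧ (β p.2 = a ∧ p.2 ∉ A)) ∧ 0 < pos p.2 - pos p.1 ∧ pos p.2 - pos p.1 < w} := by
    rw [attacks]
    congr 1
    ext p
    simp
  rw [hatt, attackInv, attackInv]
  simp only [card_filter]
  rw [← sum_add_distrib]
  refine sum_congr rfl fun p _ => ?_
  by_cases h : 0 < pos p.2 - pos p.1 ∧ pos p.2 - pos p.1 < w
  · have h1 := hβ p.1
    have h2 := hβ p.2
    have h3 : p.1 ∈ A → β p.1 = a := fun h => (mem_filter.1 (hA h)).2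
    have h4 : p.2 ∈ A → β p.2 = a := fun h => (mem_filter.1 (hA h)).2
    simp only [h, true_and, and_true, paint, ← PNat.coe_lt_coe, ← PNat.coe_inj, ne_eq,
      and_self] at h1 h2 h3 h4 ⊢
    by_cases hp : p.1 ∈ A <;> by_cases hq : p.2 ∈ A <;>
      simp only [hp, hq, if_true, if_false, forall_const, PNat.add_coe, PNat.one_coe, true_and,
        false_and, not_true_eq_false, not_false_eq_true, and_false, and_true] at h1 h2 h3 h4 ⊢ <;>
      split_ifs <;> omega
  · simp only [h, false_and, and_false, if_false, add_zero]

theorem descents_paint (pos : α → ℤ) (w : ℤ) {β : α → ℕ+} {a : ℕ+}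
    (hβ : ∀ c, β c ≠ a + 1) {A : Finset α} (hA : A ⊆ univ.filter (β · = a)) :
    descents pos w (paint β (a + 1) A) =
      descents pos w β ∪ jumps pos w A (univ.filter (β · = a) \ A) := by
  ext u
  simp only [descents, jumps, mem_union, mem_filter, mem_univ, true_and, mem_sdiff]
  have key : ∀ v, (paint β (a + 1) A v < paint β (a + 1) A u) ↔
      (β v < β u ∨ (u ∈ A ∧ β v = a ∧ v ∉ A)) := by
    intro v
    have h1 := hβ u
    have h2 := hβ v
    have h3 : u ∈ A → β u = a := fun h => (mem_filter.1 (hA h)).2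
    have h4 : v ∈ A → β v = a := fun h => (mem_filter.1 (hA h)).2
    simp only [paint, ← PNat.coe_lt_coe, ← PNat.coe_inj, ne_eq] at h1 h2 h3 h4 ⊢
    by_cases hp : u ∈ A <;> by_cases hq : v ∈ A <;>
      simp only [hp, hq, if_true, if_false, forall_const, PNat.add_coe, PNat.one_coe, true_and,
        false_and, not_true_eq_false, not_false_eq_true, and_false, and_true,
        or_false] at h1 h2 h3 h4 ⊢ <;>
      omega
  simp only [key]
  constructor
  · rintro ⟨v, hv, h | ⟨h1, h2⟩⟩
    · exact Or.inl ⟨v, hv, h⟩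
    · exact Or.inr ⟨h1, v, h2, hv⟩
  · rintro (⟨v, hv, h⟩ | ⟨h1, v, h2, hv⟩)
    · exact ⟨v, hv, Or.inl h⟩
    · exact ⟨v, hv, Or.inr ⟨h1, h2⟩⟩

end Paint
-- Fillings as merged fillings with a chosen set of raised boxes.
section Merge

variable {β : Type*}

theorem weight_apply {T : Finset β} (σ : T → ℕ+) (x : ℕ+) :
    weight σ x = #{c | σ c = x} := by
  rw [weight, Finsupp.finsetSum_apply, card_filter]
  exact sum_congr rfl fun c _ => by rw [Finsupp.single_apply]

/-- Turn all variables `x_{a+1}` of a monomial into `x_a`. -/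
def mergeWeight (a : ℕ+) (d : ℕ+ →₀ ℕ) : ℕ+ →₀ ℕ :=
  d.erase (a + 1) + Finsupp.single a (d (a + 1))

theorem succ_ne (a : ℕ+) : a + 1 ≠ a := by
  intro h
  have := congrArg PNat.val h
  simp at this

theorem mergeWeight_apply (a : ℕ+) (d : ℕ+ →₀ ℕ) (x : ℕ+) :
    mergeWeight a d x = if x = a + 1 then 0 else if x = a then d a + d (a + 1) else d x := by
  rw [mergeWeight, Finsupp.add_apply, Finsupp.erase_apply, Finsupp.single_apply]
  split_ifs with h1 h2 h3 h4 h5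
  · exact absurd (h2.trans h1).symm (succ_ne a)
  · rfl
  · rw [h4]
  · exact absurd h3.symm h4
  · exact absurd h5.symm h3
  · rfl

theorem sum_fills_eq_sum_paint [DecidableEq β] {R : Type*} [AddCommMonoid R] {T : Finset β} (a : ℕ+)
    (d : ℕ+ →₀ ℕ) (F : (T → ℕ+) → R) :
    ∑ σ ∈ fills T d, F σ = ∑ σ ∈ fills T (mergeWeight a d),
      ∑ A ∈ (univ.filter (σ · = a)).powersetCard (d (a + 1)), F (paint σ (a + 1) A) := by
  rw [sum_sigma']
  have hne := succ_ne a
  have hpaint : ∀ σ : T → ℕ+, paint (fun c => if σ c = a + 1 then a else σ c) (a + 1)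
      (univ.filter (σ · = a + 1)) = σ := by
    intro σ
    funext c
    simp only [paint, mem_filter, mem_univ, true_and]
    split_ifs with h
    · exact h.symm
    · rfl
  refine sum_nbij' (fun σ => ⟨fun c => if σ c = a + 1 then a else σ c, univ.filter (σ · = a + 1)⟩)
    (fun x => paint x.1 (a + 1) x.2) ?_ ?_ ?_ ?_ ?_
  · intro σ h
    simp only [mem_fills, mem_sigma, mem_powersetCard] at h ⊢
    refine ⟨?_, fun c hc => ?_, by rw [← h, weight_apply]⟩
    · ext x
      rw [weight_apply, mergeWeight_apply, ← h, weight_apply, weight_apply, weight_apply]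
      split_ifs with h1 h2
      · rw [card_eq_zero, filter_eq_empty_iff]
        intro c _
        rw [h1]
        split_ifs with h3
        · exact hne.symm
        · exact h3
      · rw [← card_union_of_disjoint]
        · congr 1
          ext c
          simp only [mem_filter, mem_univ, true_and, mem_union, h2]
          by_cases h3 : σ c = a + 1 <;> simp [h3]
        · rw [disjoint_filter]
          intro c _ h3 h4
          exact hne (h4.symm.trans h3)
      · congr 1
        ext c
        simp only [mem_filter, mem_univ, true_and]
        split_ifs with h3
        · rw [h3]
          exact ⟨fun h => absurd h.symm h2, fun h => absurd h.symm h1⟩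
        · rfl
    · rw [mem_filter] at hc ⊢
      simp [hc.2]
  · rintro ⟨σ, A⟩ h
    simp only [mem_fills, mem_sigma, mem_powersetCard] at h ⊢
    obtain ⟨h1, h2, h3⟩ := h
    have h0 : ∀ c, σ c ≠ a + 1 := by
      have := congrArg (fun f => f (a + 1)) h1
      simp only [weight_apply, mergeWeight_apply, if_true, card_eq_zero,
        filter_eq_empty_iff] at this
      exact fun c => this (mem_univ c)
    ext x
    have hx := congrArg (fun f => f x) h1
    simp only [weight_apply, mergeWeight_apply] at hx
    rw [weight_apply]
    by_cases hx1 : x = a + 1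
    · subst hx1
      rw [← h3]
      congr 1
      ext c
      rw [mem_filter]
      simp only [mem_univ, true_and, paint]
      by_cases hc : c ∈ A <;> simp [hc, h0]
    by_cases hx2 : x = a
    · subst hx2
      simp only [hne.symm, if_false, if_true] at hx
      have h4 : univ.filter (fun c => paint σ (x + 1) A c = x) = univ.filter (σ · = x) \ A := by
        ext c
        rw [mem_filter, mem_sdiff, mem_filter]
        simp only [mem_univ, true_and, paint]
        by_cases hc : c ∈ A <;> simp [hc, hne]
      rw [h4, card_sdiff_of_subset h2, hx, h3, Nat.add_sub_cancel]
    · simp only [hx1, hx2, if_false] at hx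
      rw [← hx]
      congr 1
      ext c
      rw [mem_filter, mem_filter]
      simp only [mem_univ, true_and, paint]
      by_cases hc : c ∈ A
      · have : σ c = a := (mem_filter.1 (h2 hc)).2
        simp [hc, this, Ne.symm hx1, Ne.symm hx2]
      · simp [hc]
  · intro σ _
    exact hpaint σ
  · rintro ⟨σ, A⟩ h
    simp only [mem_fills, mem_sigma, mem_powersetCard] at h
    obtain ⟨h1, h2, h3⟩ := h
    have h0 : ∀ c, σ c ≠ a + 1 := by
      have := congrArg (fun f => f (a + 1)) h1
      simp only [weight_apply, mergeWeight_apply, if_true, card_eq_zero,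
        filter_eq_empty_iff] at this
      exact fun c => this (mem_univ c)
    have e1 : (fun c => if paint σ (a + 1) A c = a + 1 then a else paint σ (a + 1) A c) = σ := by
      funext c
      simp only [paint]
      by_cases hc : c ∈ A
      · simp [hc, (mem_filter.1 (h2 hc)).2]
      · simp [hc, h0]
    have e2 : univ.filter (fun c => paint σ (a + 1) A c = a + 1) = A := by
      ext c
      rw [mem_filter]
      simp only [mem_univ, true_and, paint]
      by_cases hc : c ∈ A <;> simp [hc, h0]
    simp only [e1, e2]
  · intro σ _
    rw [hpaint]

end Merge

/-! ### Invariance under exchanging adjacent variables. -/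

section AdjacentSwap

variable {K : Type*} [Field K]

/-- The point is that G is independent of d': the split between the letters a and a + 1 enters only
through the size of the raised set. Once the descent set is fixed by J, the arm sum and the major
index are constant. -/
theorem coeff_macdonald_eq_sum_jumpSum {q : K} (hq : q ≠ 0) (t : K) (nu : YoungDiagram) (a : ℕ+)
    (d : ℕ+ →₀ ℕ) : ∃ G : (nu.cells → ℕ+) → Finset nu.cells → K, ∀ d' : ℕ+ →₀ ℕ,
    mergeWeight a d' = mergeWeight a d →
    MvPowerSeries.coeff d' (macdonald q t nu) =
      ∑ σ ∈ fills nu.cells (mergeWeight a d), ∑ J ∈ (univ.filter (σ · = a)).powerset, G σ J *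
        jumpSum q (fun c : nu.cells => readPos (nu.rowLen 0 + 1) c) ((nu.rowLen 0 + 1 : ℕ) : ℤ)
          (univ.filter (σ · = a)) J (d' (a + 1)) := by
  set w : ℤ := ((nu.rowLen 0 + 1 : ℕ) : ℤ) with hw
  set pos : nu.cells → ℤ := fun c => readPos (nu.rowLen 0 + 1) c with hpos
  -- The inverse power of q subtracts the arms of the descents; it needs q ≠ 0.
  refine ⟨fun σ J => q ^ attackInv pos w σ *
    (q ^ ∑ c ∈ descents pos w σ ∪ J, armLen nu c)⁻¹ *
    t ^ ∑ c ∈ descents pos w σ ∪ J, (nu.colLen (c : ℕ × ℕ).2 - ((c : ℕ × ℕ).1 + 1) + 1),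
    fun d' hd' => ?_⟩
  rw [macdonald_eq_fillingSeries, coeff_fillingSeries, sum_fills_eq_sum_paint a, hd']
  refine sum_congr rfl fun σ hσ => ?_
  have h0 : ∀ c, σ c ≠ a + 1 := by
    have := congrArg (fun f => f (a + 1)) (mem_fills.1 hσ)
    simp only [weight_apply, mergeWeight_apply, if_true, card_eq_zero,
      filter_eq_empty_iff] at this
    exact fun c => this (mem_univ c)
  set S := univ.filter (σ · = a) with hS
  simp only [jumpSum, mul_sum]
  rw [← sum_fiberwise_of_maps_to (g := fun A => jumps pos w A (S \ A)) (t := S.powerset)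
    (fun A hA => mem_powerset.2 ((filter_subset _ _).trans (mem_powersetCard.1 hA).1))]
  refine sum_congr rfl fun J _ => sum_congr rfl fun A hA => ?_
  obtain ⟨hA, hJ⟩ := mem_filter.1 hA
  have hAS := (mem_powersetCard.1 hA).1
  have h1 := attackInv_eq nu (paint σ (a + 1) A)
  rw [sum_descents_eq, descents_paint pos w h0 hAS, attackInv_paint pos w h0 hAS, hJ] at h1
  rw [majOn, sum_descents_eq nu (paint σ (a + 1) A)
    (fun c => nu.colLen c.2 - (c.1 + 1) + 1), descents_paint pos w h0 hAS, hJ]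
  have h2 := congrArg (q ^ ·) h1
  simp only [pow_add] at h2
  have h3 : q ^ ∑ c ∈ descents pos w σ ∪ J, armLen nu c ≠ 0 := pow_ne_zero _ hq
  rw [← eq_mul_inv_iff_mul_eq₀ h3] at h2
  rw [h2]
  ring

theorem coeff_macdonald_swap {q : K} (hq : q ≠ 0) (t : K) (nu : YoungDiagram) (a : ℕ+)
    {d d' : ℕ+ →₀ ℕ} (h1 : d' a = d (a + 1)) (h2 : d' (a + 1) = d a)
    (h3 : ∀ x, x ≠ a → x ≠ a + 1 → d' x = d x) :
    MvPowerSeries.coeff d' (macdonald q t nu) = MvPowerSeries.coeff d (macdonald q t nu) := by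
  have hm : mergeWeight a d' = mergeWeight a d := by
    ext x
    rw [mergeWeight_apply, mergeWeight_apply]
    split_ifs with h4 h5
    · rfl
    · rw [h1, h2, add_comm]
    · exact h3 x h5 h4
  obtain ⟨G, hG⟩ := coeff_macdonald_eq_sum_jumpSum hq t nu a d
  rw [hG d' hm, hG d rfl]
  refine sum_congr rfl fun σ hσ => sum_congr rfl fun J _ => ?_
  congr 1
  refine jumpSum_symm q (readPos_injective nu) (Nat.succ_pos _) _ _ _ _ ?_
  -- The two raised sets have sizes d a and d (a + 1), which add up to the number of merged letters
  -- a.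
  rw [← weight_apply, mem_fills.1 hσ, mergeWeight_apply, if_neg (succ_ne a).symm, if_pos rfl, h2]

end AdjacentSwap

/-! ### From adjacent swaps to full symmetry. -/

section Symmetric

variable {R : Type*} [CommRing R]

/-- The power series whose coefficients are invariant under an automorphism of the monoid of
exponents. -/
def invariantSubring (g : (ℕ+ →₀ ℕ) ≃+ (ℕ+ →₀ ℕ)) : Subring (MvPowerSeries ℕ+ R) where
  carrier := {f | ∀ d, MvPowerSeries.coeff (g d) f = MvPowerSeries.coeff d f}
  mul_mem' := by
    classical
    intro f f' hf hf' d
    rw [MvPowerSeries.coeff_mul, MvPowerSeries.coeff_mul]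
    refine sum_nbij' (fun p => (g.symm p.1, g.symm p.2)) (fun p => (g p.1, g p.2)) ?_ ?_ ?_ ?_ ?_
    · rintro ⟨x, y⟩ h
      rw [HasAntidiagonal.mem_antidiagonal] at h ⊢
      simp only at h ⊢
      rw [← map_add, h, g.symm_apply_apply]
    · rintro ⟨x, y⟩ h
      rw [HasAntidiagonal.mem_antidiagonal] at h ⊢
      simp only at h ⊢
      rw [← map_add, h]
    · rintro ⟨x, y⟩ _
      simp
    · rintro ⟨x, y⟩ _
      simp
    · rintro ⟨x, y⟩ _
      have h1 := hf (g.symm x)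
      have h2 := hf' (g.symm y)
      rw [g.apply_symm_apply] at h1 h2
      simp only [h1, h2]
  one_mem' := by
    classical
    intro d
    simp [MvPowerSeries.coeff_one]
  add_mem' := by
    intro f f' hf hf' d
    rw [map_add, map_add, hf, hf']
  zero_mem' := by
    intro d
    simp
  neg_mem' := by
    intro f hf d
    rw [map_neg, map_neg, hf]

theorem jointCumulant_mem {ι A : Type*} [Fintype ι] [DecidableEq ι] [CommRing A]
    (S : Subring A) {u : Finset ι → A} (hu : ∀ B, u B ∈ S) : jointCumulant u ∈ S := by
  rw [jointCumulant]
  refine sum_mem fun π _ => mul_mem (mul_mem (pow_mem (neg_mem S.one_mem) _) (natCast_mem S _))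
    (prod_mem fun B _ => hu B)

theorem domCongr_mul (e e' : Equiv.Perm ℕ+) (d : ℕ+ →₀ ℕ) :
    Finsupp.domCongr (e * e') d = Finsupp.domCongr e (Finsupp.domCongr e' d) := by
  ext x
  simp [Finsupp.domCongr_apply, Finsupp.equivMapDomain_apply, Equiv.Perm.mul_def]

theorem swap_invariant {X : Type*} {f : (ℕ+ →₀ ℕ) → X}
    (hf : ∀ (a : ℕ+) d, f (Finsupp.domCongr (Equiv.swap a (a + 1)) d) = f d) (n : ℕ) :
    ∀ a b : ℕ+, (b : ℕ) = a + n → ∀ d, f (Finsupp.domCongr (Equiv.swap a b) d) = f d := by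
  induction n with
  | zero =>
    intro a b h d
    have : b = a := PNat.eq h
    subst this
    rw [Equiv.swap_self]
    congr 1
    ext x
    rfl
  | succ n ih =>
    intro a b h d
    rcases Nat.eq_zero_or_pos n with rfl | hn
    · have : b = a + 1 := PNat.eq (by simpa using h)
      subst this
      exact hf a d
    · obtain ⟨c, hc⟩ : ∃ c : ℕ+, (c : ℕ) = a + n := ⟨⟨a + n, by positivity⟩, rfl⟩
      have hb : b = c + 1 := PNat.eq (by rw [PNat.add_coe, hc, h]; rfl)
      subst hb
      have hac : a ≠ c := by
        rintro rfl
        omega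
      have hab : a ≠ c + 1 := by
        intro h'
        have := congrArg PNat.val h'
        rw [PNat.add_coe] at this
        omega
      -- The swap of a and c + 1 is the swap of a and c conjugated by an adjacent swap.
      rw [Equiv.swap_comm, ← Equiv.swap_mul_swap_mul_swap hac hab, domCongr_mul, domCongr_mul,
        hf, ih a c hc, hf]

/-- On the union of the supports d and d' have fibres of equal size: multiplicities for positive
values, and the remaining elements for the value 0. Matching fibres gives the permutation. -/
theorem exists_perm_of_map_eq {d d' : ℕ+ →₀ ℕ}
    (h : d.support.val.map d = d'.support.val.map d') :
    ∃ (T : Finset ℕ+) (e : Equiv.Perm T),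
      (∀ x ∉ T, d x = 0 ∧ d' x = 0) ∧ ∀ a, d' (e a) = d a := by
  set T := d.support ∪ d'.support with hT
  have hcard : ∀ c : ℕ, #{a ∈ T | d a = c} = #{a ∈ T | d' a = c} := by
    have hpos : ∀ g : ℕ+ →₀ ℕ, g.support ⊆ T → ∀ c ≠ 0,
        #{a ∈ T | g a = c} = (g.support.val.map g).count c := by
      intro g hg c hc
      rw [Multiset.count_map, card_def]
      have : T.filter (g · = c) = g.support.filter (c = g ·) := by
        ext a
        simp only [mem_filter, Finsupp.mem_support_iff]
        constructor
        · rintro ⟨h1, rfl⟩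
          exact ⟨hc, rfl⟩
        · rintro ⟨h1, rfl⟩
          exact ⟨hg (Finsupp.mem_support_iff.2 h1), rfl⟩
      rw [this]
      rfl
    have hzero : ∀ g : ℕ+ →₀ ℕ, g.support ⊆ T →
        #{a ∈ T | g a = 0} = #T - (g.support.val.map g).card := by
      intro g hg
      rw [Multiset.card_map, ← card_def, ← card_sdiff_of_subset hg]
      congr 1
      ext a
      simp
    intro c
    by_cases hc : c = 0
    · rw [hc, hzero d subset_union_left, hzero d' subset_union_right, h]
    · rw [hpos d subset_union_left c hc, hpos d' subset_union_right c hc, h]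
  have hfib : ∀ c : ℕ, Nonempty ({a : T // d a = c} ≃ {a : T // d' a = c}) := by
    intro c
    refine Fintype.card_eq.1 ?_
    rw [Fintype.card_subtype, Fintype.card_subtype]
    have := hcard c
    rw [card_filter, card_filter, ← sum_coe_sort, ← sum_coe_sort T] at this
    rwa [card_filter, card_filter]
  refine ⟨T, Equiv.ofFiberEquiv fun c => (hfib c).some, fun x hx => ?_,
    fun a => Equiv.ofFiberEquiv_map (fun c => (hfib c).some) a⟩
  simpa only [hT, mem_union, Finsupp.mem_support_iff, not_or, not_not] using hx

/-- Coefficients invariant under all adjacent swaps of variables only depend on the multiset of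
exponents. -/
theorem eq_of_swap_invariant {X : Type*} {f : (ℕ+ →₀ ℕ) → X}
    (hf : ∀ (a : ℕ+) d, f (Finsupp.domCongr (Equiv.swap a (a + 1)) d) = f d)
    {d d' : ℕ+ →₀ ℕ} (h : d.support.val.map d = d'.support.val.map d') : f d = f d' := by
  have hswap : ∀ (a b : ℕ+) d, f (Finsupp.domCongr (Equiv.swap a b) d) = f d := by
    intro a b d
    rcases le_total a b with hab | hab
    · exact swap_invariant hf (b - a : ℕ) a b
        (by have : (a : ℕ) ≤ b := hab
            omega) d
    · rw [Equiv.swap_comm]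
      exact swap_invariant hf (a - b : ℕ) b a
        (by have : (b : ℕ) ≤ a := hab
            omega) d
  obtain ⟨T, e, hT, he⟩ := exists_perm_of_map_eq h
  have hperm : ∀ e : Equiv.Perm T, ∀ d, f (Finsupp.domCongr (Equiv.Perm.ofSubtype e) d) = f d := by
    intro e
    induction e using Equiv.Perm.swap_induction_on with
    | one =>
      intro d
      rw [map_one]
      congr 1
      ext x
      rfl
    | swap_mul e x y hxy ih =>
      intro d
      rw [map_mul, Equiv.Perm.ofSubtype_swap_eq, domCongr_mul, hswap, ih]
  have key : Finsupp.domCongr (Equiv.Perm.ofSubtype e) d = d' := by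
    ext x
    rw [Finsupp.domCongr_apply, Finsupp.equivMapDomain_apply]
    obtain ⟨y, rfl⟩ := (Equiv.Perm.ofSubtype e).surjective x
    rw [Equiv.symm_apply_apply]
    by_cases hy : y ∈ T
    · rw [Equiv.Perm.ofSubtype_apply_of_mem e hy, he ⟨y, hy⟩]
    · rw [Equiv.Perm.ofSubtype_apply_of_not_mem e hy]
      rw [(hT y hy).1, (hT y hy).2]
  rw [← key, hperm]

theorem macdonald_mem_invariantSubring {K : Type*} [Field K] {q : K} (hq : q ≠ 0) (t : K)
    (nu : YoungDiagram) (a : ℕ+) :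
    macdonald q t nu ∈ invariantSubring (Finsupp.domCongr (Equiv.swap a (a + 1))) := by
  intro d
  refine coeff_macdonald_swap hq t nu a ?_ ?_ ?_
  · simp [Finsupp.domCongr_apply, Finsupp.equivMapDomain_apply]
  · simp [Finsupp.domCongr_apply, Finsupp.equivMapDomain_apply]
  · intro x h1 h2
    simp [Finsupp.domCongr_apply, Finsupp.equivMapDomain_apply, Equiv.swap_apply_of_ne_of_ne h1 h2]

/-- Invariant series form a subring, so the symmetry of Macdonald polynomials passes to their
cumulants. -/
theorem coeff_fullyColored_eq (mu : YoungDiagram) {d d' : ℕ+ →₀ ℕ}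
    (h : d.support.val.map d = d'.support.val.map d') :
    MvPowerSeries.coeff d (fullyColored mu) = MvPowerSeries.coeff d' (fullyColored mu) := by
  refine eq_of_swap_invariant (f := fun d => MvPowerSeries.coeff d (fullyColored mu))
    (fun a d => ?_) h
  simp only [fullyColored, macdonaldCumulant, MvPowerSeries.coeff_smul]
  congr 1
  exact jointCumulant_mem (invariantSubring (Finsupp.domCongr (Equiv.swap a (a + 1))))
    (fun B => macdonald_mem_invariantSubring RatFunc.X_ne_zero _ _ a) d

end Symmetric
-- Polynomiality in q, the value at -1 and monomial positivity.
section Coefficients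

open Polynomial

/-- The inversion polynomial of a multigraph on `Fin r`. -/
def invPoly {r : ℕ} (e : Fin r → Fin r → ℕ) : ℤ[X] := (exists_inversionPoly e univ).choose

theorem cumulant_eq_invPoly {r : ℕ} (e : Fin r → Fin r → ℕ) :
    cumulant (fun B => (X : ℤ[X]) ^ edgeCount e B) univ = (X - 1) ^ (r - 1) * invPoly e := by
  have h : cumulant (fun B => (X : ℤ[X]) ^ edgeCount e B) univ =
      (X - 1) ^ (#(univ : Finset (Fin r)) - 1) * invPoly e :=
    (exists_inversionPoly e univ).choose_spec.1
  rw [h, card_univ, Fintype.card_fin]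

theorem invPoly_eval_nonneg {r : ℕ} (e : Fin r → Fin r → ℕ) : 0 ≤ (invPoly e).eval (-1) :=
  (exists_inversionPoly e univ).choose_spec.2

theorem coeff_fullyColored (mu : YoungDiagram) (d : ℕ+ →₀ ℕ) :
    MvPowerSeries.coeff d (fullyColored mu) = algebraMap Qt[X] Qqt
      (∑ σ ∈ fills mu.cells d, C ((RatFunc.X : Qt) ^ majOn mu.colLen mu.cells (extendOne σ)) *
        (invPoly (r := mu.rowLen 0) (columnInv mu (extendOne σ))).map (Int.castRingHom Qt)) := by
  set φ : ℤ[X] →+* Qqt := (algebraMap Qt[X] Qqt).comp (mapRingHom (Int.castRingHom Qt)) with hφ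
  have hX : φ X = RatFunc.X := by
    rw [hφ, RingHom.comp_apply, coe_mapRingHom, map_X, RatFunc.algebraMap_X]
  rw [fullyColored, macdonaldCumulant, MvPowerSeries.coeff_smul, coeff_cumulant_columns, map_sum,
    mul_sum]
  refine sum_congr rfl fun σ _ => ?_
  have h1 := congrArg φ (cumulant_eq_invPoly (r := mu.rowLen 0) (columnInv mu (extendOne σ)))
  rw [map_cumulant] at h1
  simp only [map_pow, map_mul, map_sub, map_one, hX] at h1
  rw [h1]
  have h2 : ((RatFunc.X : Qqt) - 1) ^ (mu.rowLen 0 - 1) ≠ 0 := by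
    refine pow_ne_zero _ ?_
    rw [← hX, ← map_one φ, ← map_sub, hφ, RingHom.comp_apply]
    refine (map_ne_zero_iff _ (RatFunc.algebraMap_injective Qt)).2 ?_
    simpa using X_sub_C_ne_zero (1 : Qt)
  rw [mul_left_comm, inv_mul_cancel_left₀ h2, map_mul, RatFunc.algebraMap_C, map_pow]
  rfl

theorem regularAt_fullyColored (mu : YoungDiagram) (a : Qt) : RegularAt a (fullyColored mu) := by
  intro d
  rw [coeff_fullyColored, RatFunc.denom_algebraMap, eval_one]
  exact one_ne_zero

/-- The contribution of a filling to the specialization at `q = -1`. -/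
def fillingTerm (mu : YoungDiagram) (s : ℕ × ℕ → ℕ+) : ℕ[X] :=
  monomial (majOn mu.colLen mu.cells s)
    ((invPoly (r := mu.rowLen 0) (columnInv mu s)).eval (-1)).toNat

/-- `ofNatPoly` as a ring homomorphism. -/
def ofNatPolyHom : ℕ[X] →+* Qt :=
  (algebraMap ℚ[X] Qt).comp (mapRingHom (Nat.castRingHom ℚ))

theorem ofNatPoly_eq (p : ℕ[X]) : ofNatPoly p = ofNatPolyHom p := rfl

/-- Nonnegativity of the inversion polynomials at -1 is what makes the `toNat` in `fillingTerm`
lossless. -/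
theorem specialize_fullyColored (mu : YoungDiagram) (d : ℕ+ →₀ ℕ) :
    MvPowerSeries.coeff d (specialize (-1) (fullyColored mu)) =
      ofNatPoly (∑ σ ∈ fills mu.cells d, fillingTerm mu (extendOne σ)) := by
  change RatFunc.eval (RingHom.id Qt) (-1) (MvPowerSeries.coeff d (fullyColored mu)) = _
  rw [coeff_fullyColored, RatFunc.eval_algebraMap, ofNatPoly_eq, map_sum ofNatPolyHom,
    Algebra.algebraMap_self_apply, eval₂_id, eval_finsetSum]
  refine sum_congr rfl fun σ _ => ?_
  rw [eval_mul, eval_C, eval_map, fillingTerm, ofNatPolyHom, RingHom.comp_apply, coe_mapRingHom,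
    map_monomial, ← C_mul_X_pow_eq_monomial, map_mul, map_pow, RatFunc.algebraMap_X, mul_comm]
  congr 1
  have h := invPoly_eval_nonneg (r := mu.rowLen 0) (columnInv mu (extendOne σ))
  have h1 : eval₂ (Int.castRingHom Qt) (-1)
      (invPoly (r := mu.rowLen 0) (columnInv mu (extendOne σ))) =
      (((invPoly (r := mu.rowLen 0) (columnInv mu (extendOne σ))).eval (-1) : ℤ) : Qt) := by
    rw [← eq_intCast (Int.castRingHom Qt), ← eval₂_at_apply]
    simp
  obtain ⟨m, hm⟩ := Int.eq_ofNat_of_zero_le h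
  rw [h1, hm]
  simp

theorem degree_of_mem_fills {β : Type*} [DecidableEq β] {T : Finset β} {d : ℕ+ →₀ ℕ} {σ : T → ℕ+}
    (h : σ ∈ fills T d) : (d.support.val.map d).sum = #T := by
  have h1 : (d.support.val.map d).sum = d.degree := rfl
  rw [h1, ← mem_fills.1 h, weight, map_sum]
  simp

theorem monomial_positive (mu : YoungDiagram) :
    ∃ c : mu.card.Partition → ℕ[X],
      specialize (-1) (fullyColored mu) = ∑ ν : mu.card.Partition,
        ofNatPoly (c ν) • monomialSymm ν := by
  classical
  -- By symmetry any exponent vector of type ν yields the coefficient of m_ν. The default 0 is never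
  -- read, since a monomial only meets the ν of its own type.
  refine ⟨fun ν => if h : ∃ d : ℕ+ →₀ ℕ, d.support.val.map d = ν.parts then
    ∑ σ ∈ fills mu.cells h.choose, fillingTerm mu (extendOne σ) else 0, ?_⟩
  ext d
  have hcoeff : ∀ ν : mu.card.Partition, MvPowerSeries.coeff d (monomialSymm (R := Qt) ν) =
      if d.support.val.map d = ν.parts then 1 else 0 := fun ν => rfl
  rw [map_sum]
  simp only [MvPowerSeries.coeff_smul, hcoeff]
  by_cases hd : (d.support.val.map d).sum = mu.card
  · let ν : mu.card.Partition := ⟨d.support.val.map d, by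
      intro i hi
      obtain ⟨x, hx, rfl⟩ := Multiset.mem_map.1 hi
      exact Nat.pos_of_ne_zero (Finsupp.mem_support_iff.1 hx), hd⟩
    have hν : d.support.val.map d = ν.parts := rfl
    have hex : ∃ d : ℕ+ →₀ ℕ, d.support.val.map d = ν.parts := ⟨d, hν⟩
    rw [sum_eq_single ν, if_pos hν, dif_pos hex, mul_one,
      ← specialize_fullyColored]
    · change RatFunc.eval (RingHom.id Qt) (-1) (MvPowerSeries.coeff d (fullyColored mu)) =
        RatFunc.eval (RingHom.id Qt) (-1) (MvPowerSeries.coeff hex.choose (fullyColored mu))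
      rw [coeff_fullyColored_eq mu (hν.trans hex.choose_spec.symm)]
    · intro ν' _ hne
      rw [if_neg, mul_zero]
      exact fun h => hne (Nat.Partition.ext h.symm)
    · exact fun h => absurd (mem_univ _) h
  · have hfills : fills mu.cells d = ∅ :=
      eq_empty_of_forall_notMem fun σ hσ => hd (degree_of_mem_fills hσ)
    rw [specialize_fullyColored, hfills, sum_empty, ofNatPoly_eq, map_zero, sum_eq_zero]
    · intro ν _
      rw [if_neg, mul_zero]
      exact fun h => hd (by rw [h, ν.parts_sum])

end Coefficients

/-! ### Standardization and fundamental positivity. -/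

section Standardization

theorem exists_equiv_strictMono {α : Type*} [Fintype α] {pos : α → ℤ} (hpos : pos.Injective)
    {n : ℕ} (hn : Fintype.card α = n) : ∃ ρ : Fin n ≃ α, StrictMono (pos ∘ ρ) := by
  let _ : LinearOrder α := LinearOrder.lift' pos hpos
  let e := monoEquivOfFin α hn
  exact ⟨e.toEquiv, fun a b hab => e.strictMono hab⟩

/-- For an inversion pair outside the first row, left box, right box and box below the left one come
in this reading order, so strict drops along the reading order decide every comparison in `Triple`.
In the first row the entry 0 is below everything. -/
theorem fillingTerm_congr (mu : YoungDiagram) {s s' : ℕ × ℕ → ℕ+}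
    (h : ∀ u ∈ mu.cells, ∀ v ∈ mu.cells,
      readPos (mu.rowLen 0 + 1) u < readPos (mu.rowLen 0 + 1) v → (s v < s u ↔ s' v < s' u)) :
    fillingTerm mu s = fillingTerm mu s' := by
  have hdes : ∀ c ∈ mu.cells, c.1 ≠ 0 → (below s c < s c ↔ below s' c < s' c) := by
    rintro ⟨i, j⟩ hc h0
    obtain ⟨i, rfl⟩ := Nat.exists_eq_succ_of_ne_zero h0
    have hv : (i, j) ∈ mu.cells :=
      mu.isLowerSet (Prod.mk_le_mk.2 ⟨Nat.le_succ i, le_rfl⟩ : (i, j) ≤ (i + 1, j)) hc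
    refine h _ hc _ hv ?_
    have := (readPos_eq_iff (w := mu.rowLen 0 + 1) (snd_lt_width hc) (snd_lt_width hv)).2
      ⟨rfl, rfl⟩
    rw [this]
    push_cast
    omega
  have htri : ∀ c ∈ mu.cells, ∀ c' ∈ mu.cells, c.1 = c'.1 → c.2 < c'.2 →
      (Triple s c c' ↔ Triple s' c c') := by
    rintro ⟨i, j⟩ hc ⟨i', j'⟩ hc' hi hj
    simp only at hi hj
    subst hi
    have hcc := (readPos_sub_mem (snd_lt_width hc) (snd_lt_width hc')).2 (Or.inl ⟨rfl, hj⟩)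
    have h1 := h _ hc _ hc' (by omega)
    have h2 := hdes _ hc
    rcases i with _ | i
    · have e1 : below s (0, j) = 0 := rfl
      have e2 : below s' (0, j) = 0 := rfl
      have p1 := (s (0, j)).pos
      have p2 := (s' (0, j)).pos
      have p3 := (s (0, j')).pos
      have p4 := (s' (0, j')).pos
      simp only [Triple, e1, e2, ← PNat.coe_lt_coe] at h1 ⊢
      omega
    · have hv : (i, j) ∈ mu.cells :=
        mu.isLowerSet (Prod.mk_le_mk.2 ⟨Nat.le_succ i, le_rfl⟩ : (i, j) ≤ (i + 1, j)) hc
      have hcv := (readPos_sub_mem (snd_lt_width hc') (snd_lt_width hv)).2 (Or.inr ⟨rfl, hj⟩)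
      have h3 := h _ hc' _ hv (by omega)
      have h2 := h2 (Nat.succ_ne_zero i)
      have e1 : below s (i + 1, j) = s (i, j) := rfl
      have e2 : below s' (i + 1, j) = s' (i, j) := rfl
      simp only [Triple, e1, e2, ← PNat.coe_lt_coe] at h1 h2 h3 ⊢
      omega
  have hinv : columnInv (r := mu.rowLen 0) mu s = columnInv mu s' := by
    funext j k
    rw [columnInv, columnInv]
    congr 1
    refine filter_congr fun p hp => ?_
    obtain ⟨h1, h2⟩ := mem_product.1 hp
    constructor
    · rintro ⟨h3, h4, h5, h6, h7⟩
      exact ⟨h3, h4, h5, h6, (htri _ h1 _ h2 h5 h6).1 h7⟩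
    · rintro ⟨h3, h4, h5, h6, h7⟩
      exact ⟨h3, h4, h5, h6, (htri _ h1 _ h2 h5 h6).2 h7⟩
  have hmaj : majOn mu.colLen mu.cells s = majOn mu.colLen mu.cells s' := by
    rw [majOn, majOn]
    refine sum_congr (filter_congr fun c hc => ?_) fun _ _ => rfl
    constructor
    · rintro ⟨h1, h2⟩
      exact ⟨h1, (hdes c hc h1).1 h2⟩
    · rintro ⟨h1, h2⟩
      exact ⟨h1, (hdes c hc h1).2 h2⟩
  rw [fillingTerm, fillingTerm, hinv, hmaj]

variable {n : ℕ}

/-- The descent set of a permutation, as a subset of `{1, …, n - 1}`. -/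
def permDescents (τ : Equiv.Perm (Fin n)) : Finset ℕ :=
  {a ∈ Icc 1 (n - 1) | ∃ x y : Fin n, (x : ℕ) + 1 = a ∧ (y : ℕ) = a ∧ τ y < τ x}

theorem mem_permDescents {τ : Equiv.Perm (Fin n)} {x y : Fin n} (hxy : (y : ℕ) = x + 1) :
    (x : ℕ) + 1 ∈ permDescents τ ↔ τ y < τ x := by
  rw [permDescents, mem_filter, mem_Icc]
  constructor
  · rintro ⟨-, x', y', h1, h2, h3⟩
    have e1 : x' = x := Fin.ext (by omega)
    have e2 : y' = y := Fin.ext (by omega)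
    rwa [e1, e2] at h3
  · intro h
    exact ⟨⟨by omega, by omega⟩, x, y, rfl, hxy, h⟩

/-- Stable sorting asks τ to increase on every run of equal values. It suffices to test neighbours
in a run, and there the condition says that values rise strictly at each descent of τ. -/
theorem sort_eq_iff (τ : Equiv.Perm (Fin n)) (w : Fin n → ℕ+) :
    Tuple.sort w = τ ↔ Monotone (w ∘ τ) ∧
      ∀ a b : Fin n, (b : ℕ) = a + 1 → (a : ℕ) + 1 ∈ permDescents τ → (w ∘ τ) a < (w ∘ τ) b := by
  rw [eq_comm, Tuple.eq_sort_iff]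
  refine and_congr_right fun hmono => ?_
  constructor
  · intro h a b hab hD
    rw [mem_permDescents hab] at hD
    have hlt : a < b := Fin.lt_def.2 (by omega)
    exact lt_of_le_of_ne (hmono hlt.le) fun heq => (h a b hlt heq).not_gt hD
  · intro h
    have key : ∀ (m : ℕ) (a b : Fin n), (b : ℕ) = a + m + 1 → w (τ a) = w (τ b) → τ a < τ b := by
      intro m
      induction m with
      | zero =>
        intro a b hab heq
        by_contra hle
        have hne : a ≠ b := by
          rintro rfl
          omega
        have hlt : τ b < τ a :=
          lt_of_le_of_ne (not_lt.1 hle) fun h' => hne (τ.injective h').symm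
        exact (h a b hab ((mem_permDescents hab).2 hlt)).ne heq
      | succ m ih =>
        intro a b hab heq
        have hc : (b : ℕ) - 1 < n := by omega
        let c : Fin n := ⟨(b : ℕ) - 1, hc⟩
        have hcv : (c : ℕ) = (b : ℕ) - 1 := rfl
        have hac : a ≤ c := Fin.le_def.2 (by omega)
        have hcb : c ≤ b := Fin.le_def.2 (by omega)
        have e1 : w (τ a) = w (τ c) := le_antisymm (hmono hac) (heq ▸ hmono hcb)
        refine (ih a c (by omega) e1).trans ?_
        have e2 : w (τ c) = w (τ b) := e1 ▸ heq
        by_contra hle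
        have hne : c ≠ b := by
          intro h'
          have := congrArg Fin.val h'
          omega
        have hlt : τ b < τ c :=
          lt_of_le_of_ne (not_lt.1 hle) fun h' => hne (τ.injective h').symm
        have hcb' : (b : ℕ) = c + 1 := by omega
        exact (h c b hcb' ((mem_permDescents hcb').2 hlt)).ne e2
    intro a b hab heq
    exact key (b - a - 1) a b (by have := Fin.lt_def.1 hab; omega) heq

theorem sort_symm_lt_iff (w : Fin n → ℕ+) {x y : Fin n} (hxy : x < y) :
    w y < w x ↔ (Tuple.sort w).symm y < (Tuple.sort w).symm x := by
  obtain ⟨h1, h2⟩ := Tuple.eq_sort_iff.1 (rfl : Tuple.sort w = Tuple.sort w)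
  obtain ⟨a, rfl⟩ := (Tuple.sort w).surjective x
  obtain ⟨b, rfl⟩ := (Tuple.sort w).surjective y
  rw [Equiv.symm_apply_apply, Equiv.symm_apply_apply]
  constructor
  · intro h
    by_contra hle
    exact (h1 (not_lt.1 hle)).not_gt h
  · intro h
    exact lt_of_le_of_ne (h1 h.le) fun heq => (h2 b a h heq).not_gt hxy

theorem mem_fundamentalSeqs {D : Finset ℕ} {d : ℕ+ →₀ ℕ} {i : Fin n → ℕ+} :
    i ∈ fundamentalSeqs n D d ↔ Monotone i ∧
      (∀ a b : Fin n, (b : ℕ) = a + 1 → (a : ℕ) + 1 ∈ D → i a < i b) ∧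
        ∑ a, Finsupp.single (i a) 1 = d := by
  simp only [fundamentalSeqs, mem_filter, Fintype.mem_piFinset, and_iff_right_iff_imp]
  rintro ⟨-, -, rfl⟩ c
  rw [Finsupp.mem_support_iff, Finsupp.finsetSum_apply]
  exact (lt_of_lt_of_le (by simp) (single_le_sum
    (f := fun c' => (Finsupp.single (i c') 1 : ℕ+ →₀ ℕ) (i c)) (fun _ _ => Nat.zero_le _)
    (mem_univ c))).ne'

theorem card_sort_fiber {β : Type*} [DecidableEq β] {T : Finset β} (ρ : Fin n ≃ T)
    (τ : Equiv.Perm (Fin n)) (d : ℕ+ →₀ ℕ) :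
    #{σ ∈ fills T d | Tuple.sort (σ ∘ ρ) = τ} = #(fundamentalSeqs n (permDescents τ) d) := by
  refine card_nbij' (fun σ => σ ∘ ρ ∘ τ) (fun i => i ∘ τ.symm ∘ ρ.symm) ?_ ?_ ?_ ?_
  · intro σ h
    obtain ⟨h1, h2⟩ := mem_filter.1 (mem_coe.1 h)
    rw [sort_eq_iff] at h2
    refine mem_coe.2 (mem_fundamentalSeqs.2 ⟨h2.1, h2.2, ?_⟩)
    rw [← mem_fills.1 h1, weight]
    exact (τ.trans ρ).sum_comp fun c => Finsupp.single (σ c) 1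
  · intro i h
    obtain ⟨h1, h2, h3⟩ := mem_fundamentalSeqs.1 (mem_coe.1 h)
    have e : (i ∘ τ.symm ∘ ρ.symm) ∘ ρ ∘ τ = i := by
      funext x
      simp
    refine mem_coe.2 (mem_filter.2 ⟨?_, ?_⟩)
    · rw [mem_fills, ← h3, weight]
      exact (ρ.symm.trans τ.symm).sum_comp fun c => Finsupp.single (i c) 1
    · rw [sort_eq_iff, Function.comp_assoc, e]
      exact ⟨h1, h2⟩
  · intro σ _
    funext x
    simp
  · intro i _
    funext x
    simp

theorem fundamental_positive (mu : YoungDiagram) :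
    ∃ c : Finset ℕ → Polynomial ℕ,
      specialize (-1) (fullyColored mu) = ∑ D ∈ (Icc 1 (mu.card - 1)).powerset,
        ofNatPoly (c D) • fundamental mu.card D := by
  obtain ⟨ρ, hρ⟩ := exists_equiv_strictMono (readPos_injective mu) (n := mu.card)
    (Fintype.card_coe _)
  -- The standard filling of τ puts in each box its rank in sorted order, shifted by one to be
  -- positive; it represents all fillings that sort to τ.
  set term : Equiv.Perm (Fin mu.card) → Polynomial ℕ := fun τ =>
    fillingTerm mu (extendOne fun c : mu.cells => ((τ.symm (ρ.symm c) : Fin _) : ℕ).succPNat)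
    with hterm
  refine ⟨fun D => ∑ τ with permDescents τ = D, term τ, ?_⟩
  ext d
  have hF : ∀ D, MvPowerSeries.coeff d (fundamental (R := Qt) mu.card D) =
      (#(fundamentalSeqs mu.card D d) : Qt) := fun D => rfl
  rw [specialize_fullyColored, map_sum]
  simp only [MvPowerSeries.coeff_smul, hF, ofNatPoly_eq, map_sum, sum_mul]
  have h1 : ∀ D ∈ (Icc 1 (mu.card - 1)).powerset,
      ∑ τ with permDescents τ = D, ofNatPolyHom (term τ) * (#(fundamentalSeqs mu.card D d) : Qt) =
      ∑ τ with permDescents τ = D,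
        ofNatPolyHom (term τ) * (#(fundamentalSeqs mu.card (permDescents τ) d) : Qt) :=
    fun D _ => sum_congr rfl fun τ hτ => by rw [(mem_filter.1 hτ).2]
  rw [sum_congr rfl h1, sum_fiberwise_of_maps_to (g := permDescents)
    fun τ _ => mem_powerset.2 (filter_subset _ _)]
  -- Fillings are grouped by their sorting permutation: the term is constant on each group, and
  -- `card_sort_fiber` counts the group.
  rw [← sum_fiberwise_of_maps_to (g := fun σ : mu.cells → ℕ+ => Tuple.sort (σ ∘ ρ)) (t := univ)
    fun _ _ => mem_univ _]
  refine sum_congr rfl fun τ _ => ?_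
  rw [← card_sort_fiber ρ τ d, mul_comm, ← nsmul_eq_mul, ← sum_const]
  refine sum_congr rfl fun σ hσ => ?_
  obtain ⟨-, rfl⟩ := mem_filter.1 hσ
  congr 1
  refine fillingTerm_congr mu fun u hu v hv huv => ?_
  rw [extendOne_of_mem _ hu, extendOne_of_mem _ hv, extendOne_of_mem _ hu, extendOne_of_mem _ hv]
  have hlt : ρ.symm ⟨u, hu⟩ < ρ.symm ⟨v, hv⟩ := by
    rw [← hρ.lt_iff_lt]
    simpa using huv
  have h2 := sort_symm_lt_iff (σ ∘ ρ) hlt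
  simp only [Function.comp_apply, Equiv.apply_symm_apply] at h2
  rw [h2, Nat.succPNat_lt_succPNat, Fin.lt_def]

end Standardization
end

end ColoredMacdonald

theorem mainTheorem8 (mu : YoungDiagram) :
    ColoredMacdonald.RegularAt (-1) (ColoredMacdonald.fullyColored mu) ∧
    (∃ c : mu.card.Partition → Polynomial ℕ,
      ColoredMacdonald.specialize (-1) (ColoredMacdonald.fullyColored mu) =
        ∑ ν : mu.card.Partition,
          ColoredMacdonald.ofNatPoly (c ν) • ColoredMacdonald.monomialSymm ν) ∧
    (∃ c : Finset ℕ → Polynomial ℕ,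
      ColoredMacdonald.specialize (-1) (ColoredMacdonald.fullyColored mu) =
        ∑ D ∈ (Finset.Icc 1 (mu.card - 1)).powerset,
          ColoredMacdonald.ofNatPoly (c D) • ColoredMacdonald.fundamental mu.card D) :=
  ⟨ColoredMacdonald.regularAt_fullyColored mu (-1), ColoredMacdonald.monomial_positive mu,
    ColoredMacdonald.fundamental_positive mu⟩
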